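/- **Notation.** For complex matrices, $X^{\#}$ is entrywise conjugation, $X^\dagger$ the adjoint, $\Delta(A,B)=\begin{pmatrix}A&B\\B^{\#}&A^{\#}\end{pmatrix}$, $J=\mathrm{diag}(\mathbb 1,-\mathbb 1)$ and $Z^\flat=JZ^\dagger J$. A square matrix $T$ is *symplectic* if $T=\Delta(T_-,T_+)$ and $T^\flat T=TT^\flat=\mathbb 1$. A *quantum linear system* (QLS) with $n$ modes and $m$ channels is a triple $\mathcal G=(S,C,\Omega)$ with $S\in\mathbb C^{2m\times 2m}$ symplectic, $C=\Delta(C_-,C_+)\in\mathbb C^{2m\times 2n}$ and $\Omega=\Delta(\Omega_-,\Omega_+)\in\mathbb C^{2n\times 2n}$, where $\Omega_-=\Omega_-^\dagger$, $\Omega_+=\Omega_+^T$. Put $A=-\tfrac12C^\flat C-iJ\Omega$. All systems are assumed Hurwitz (the eigenvalues of $A$ have strictly negative real part). The transfer function is $\Xi(s)=\big(\mathbb 1-C(s-A)^{-1}C^\flat\big)S$ and, for an input covariance $V$, the power spectrum is $\Psi_V(s)=\Xi(s)V\,\Xi(-s^{\#})^\dagger$. The system is *globally minimal* for $V$ if no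 (Hurwitz) QLS with fewer modes and the same $m$ channels has the same power spectrum $\Psi_V$. It is *passive* if $S$, $C$, $\Omega$ have vanishing off-diagonal blocks ($S_+=C_+=\Omega_+=0$). For a covariance matrix $P$ of $k$ modes, a *canonical basis* is a symplectic $T$ with $TPT^\dagger=\begin{pmatrix}D+\mathbb 1&0\\0&D\end{pmatrix}$, $D=\mathrm{diag}(\nu_1,\dots,\nu_k)$, $\nu_i\ge 0$. The state is *pure* if all $\nu_i=0$ and *fully mixed* if all $\nu_i>0$; the modes with $\nu_i=0$ are called pure, those with $\nu_i>0$ mixed. The *series product* of $\mathcal G_j=(S_j,C_j,\Omega_j)$, $j=1,2$ (output of $\mathcal G_1$ fed into $\mathcal G_2$) is $\mathcal G_2\triangleleft\mathcal G_1=(S,C,\Omega)$ with $S=S_2S_1$, $C=\tilde C_2+S_2\tilde C_1$ and $J\Omega=J\tilde\Omega_1+J\tilde\Omega_2+\mathrm{Im}_\flat(\tilde C_2^\flat S_2\tilde C_1)$, where tildes denote padding by zero blocks and $\mathrm{Im}_\flat X=(X-X^\flat)/2i$. **Theorem.** Let $\mathcal G=(S,C,\Omega)$ be a Hurwitz QLS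 with $n$ modes and $m$ channels, driven by a pure Gaussian (squeezed) input of covariance $V=\begin{pmatrix}N^T+\mathbb 1&M\\M^\dagger&N\end{pmatrix}$. The Lyapunov equation $$AP+PA^\dagger+C^\flat\,(SVS^\dagger)\,(C^\flat)^\dagger=0$$ of the stationary Gaussian state has exactly one solution $P$, $P$ has a canonical basis, and: 1. $\mathcal G$ is globally minimal for $V$ if and only if the state with covariance $P$ is fully mixed. 2. Suppose that $\mathcal G$ is not globally minimal. Let $T$ be any canonical basis of $P$, and write $\mathcal G$ in the mode coordinates given by $T$, that is, as $(S,CT^\flat,\Omega')$ with $J\Omega'=TJ\Omega T^\flat$. Let $C^p,\Omega^{pp}$ and $C^m,\Omega^{mm}$ be the restrictions of $CT^\flat$ and $\Omega'$ to the pure and to the mixed modes. Then there is at least one pure mode, and $\mathcal G$ in these coordinates is the series product $\mathcal G^m\triangleleft\mathcal G^p$ of the pure component $\mathcal G^p=(\mathbb 1,S^\flat C^p,\Omega^{pp})$ and the mixed component $\mathcal G^m=(S,C^m,\Omega^{mm})$ (so $\mathcal G^p=(\mathbb 1,C^p,\Omega^{pp})$ if $S=\mathbb 1$). Both components are Hurwitz,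 and $\mathcal G^p$ is passive in any field coordinates in which the input is the vacuum: if $R$ is symplectic with $RVR^\dagger=\begin{pmatrix}\mathbb 1&0\\0&0\end{pmatrix}$, then $(\mathbb 1,RS^\flat C^p,\Omega^{pp})$ is passive. 3. In the situation of 2, the mixed component $\mathcal G^m$ is globally minimal for $V$ and has the same power spectrum $\Psi_V$ as $\mathcal G$. -/

import Mathlib

open Matrix

noncomputable section

namespace QuantumLinear

variable {α β γ : Type*}

/-- The doubled-up matrix `Δ(A, B) = [A, B; B^#, A^#]`, where `#` is entrywise conjugation. -/
def Delta (A B : Matrix α β ℂ) : Matrix (α ⊕ α) (β ⊕ β) ℂ :=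
  fromBlocks A B (B.map star) (A.map star)

/-- `X` has the doubled-up form `Δ(A, B)`. -/
def IsDoubled (X : Matrix (α ⊕ α) (β ⊕ β) ℂ) : Prop :=
  ∃ A B : Matrix α β ℂ, X = Delta A B

/-- The commutation matrix `J = diag(1, -1)` on doubled-up coordinates. -/
def Jmat (α : Type*) [DecidableEq α] : Matrix (α ⊕ α) (α ⊕ α) ℂ :=
  fromBlocks 1 0 0 (-1)

/-- `Z^♭ = J Z† J`. -/
def flat [Fintype α] [DecidableEq α] [Fintype β] [DecidableEq β]
    (Z : Matrix (α ⊕ α) (β ⊕ β) ℂ) : Matrix (β ⊕ β) (α ⊕ α) ℂ :=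
  Jmat β * Zᴴ * Jmat α

/-- Symplectic (Bogoliubov) matrices: `♭`-unitary and of doubled-up form. -/
structure IsSymplectic [Fintype α] [DecidableEq α]
    (T : Matrix (α ⊕ α) (α ⊕ α) ℂ) : Prop where
  doubled : IsDoubled T
  flat_mul : flat T * T = 1
  mul_flat : T * flat T = 1

/-- Covariance matrix `⟨c̆ c̆†⟩` of independent modes with mean photon numbers `ν i`:
mode `i` has covariance `diag (ν i + 1, ν i)`. -/
def thermalCov [DecidableEq α] (ν : α → ℝ) : Matrix (α ⊕ α) (α ⊕ α) ℂ :=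
  fromBlocks (diagonal fun i => (ν i : ℂ) + 1) 0 0 (diagonal fun i => (ν i : ℂ))

/-- `c̆' = T c̆` is a canonical basis for the Gaussian state with covariance `P`, with symplectic
eigenvalues (mean photon numbers) `ν`. -/
structure IsCanonicalBasis [Fintype α] [DecidableEq α]
    (P T : Matrix (α ⊕ α) (α ⊕ α) ℂ) (ν : α → ℝ) : Prop where
  symplectic : IsSymplectic T
  nonneg : ∀ i, 0 ≤ ν i
  cov_eq : T * P * Tᴴ = thermalCov ν

/-- The Gaussian state with covariance `P` is pure: all symplectic eigenvalues vanish. -/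
def IsPureState [Fintype α] [DecidableEq α] (P : Matrix (α ⊕ α) (α ⊕ α) ℂ) : Prop :=
  ∃ T, IsCanonicalBasis P T 0

/-- The Gaussian state with covariance `P` is fully mixed: all symplectic eigenvalues are
strictly positive. -/
def IsFullyMixed [Fintype α] [DecidableEq α] (P : Matrix (α ⊕ α) (α ⊕ α) ℂ) : Prop :=
  ∃ T ν, IsCanonicalBasis P T ν ∧ ∀ i, 0 < ν i

/-- The input covariance `V(N, M) = [Nᵀ + 1, M; M†, N]`. -/
def inputCov [DecidableEq α] (N M : Matrix α α ℂ) : Matrix (α ⊕ α) (α ⊕ α) ℂ :=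
  fromBlocks (Nᵀ + 1) M Mᴴ N

section helpers

theorem IsDoubled.mul [Fintype β] {X : Matrix (α ⊕ α) (β ⊕ β) ℂ} {Y : Matrix (β ⊕ β) (γ ⊕ γ) ℂ}
    (hX : IsDoubled X) (hY : IsDoubled Y) : IsDoubled (X * Y) := by
  obtain ⟨A, B, rfl⟩ := hX
  obtain ⟨A', B', rfl⟩ := hY
  refine ⟨A * A' + B * B'.map star, A * B' + B * A'.map star, ?_⟩
  unfold Delta
  rw [fromBlocks_multiply]
  congr 1 <;> ext i j <;>
    simp [Matrix.mul_apply, Matrix.add_apply, Matrix.map_apply, add_comm]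

theorem IsDoubled.add {X Y : Matrix (α ⊕ α) (β ⊕ β) ℂ}
    (hX : IsDoubled X) (hY : IsDoubled Y) : IsDoubled (X + Y) := by
  obtain ⟨A, B, rfl⟩ := hX
  obtain ⟨A', B', rfl⟩ := hY
  refine ⟨A + A', B + B', ?_⟩
  unfold Delta
  rw [fromBlocks_add]
  congr 1 <;> ext i j <;> simp

theorem IsDoubled.sub {X Y : Matrix (α ⊕ α) (β ⊕ β) ℂ}
    (hX : IsDoubled X) (hY : IsDoubled Y) : IsDoubled (X - Y) := by
  obtain ⟨A, B, rfl⟩ := hX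
  obtain ⟨A', B', rfl⟩ := hY
  refine ⟨A - A', B - B', ?_⟩
  unfold Delta
  rw [sub_eq_add_neg, fromBlocks_neg, fromBlocks_add]
  congr 1 <;> ext i j <;> simp [sub_eq_add_neg]

theorem IsDoubled.conjTranspose {X : Matrix (α ⊕ α) (β ⊕ β) ℂ}
    (hX : IsDoubled X) : IsDoubled Xᴴ := by
  obtain ⟨A, B, rfl⟩ := hX
  refine ⟨Aᴴ, Bᵀ, ?_⟩
  unfold Delta
  rw [fromBlocks_conjTranspose]
  congr 1 <;> ext i j <;> simp

theorem IsDoubled.flat [Fintype α] [DecidableEq α] [Fintype β] [DecidableEq β]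
    {X : Matrix (α ⊕ α) (β ⊕ β) ℂ} (hX : IsDoubled X) : IsDoubled (flat X) := by
  obtain ⟨A, B, hA⟩ := hX.conjTranspose
  refine ⟨A, -B, ?_⟩
  unfold QuantumLinear.flat Jmat
  rw [hA]
  unfold Delta
  rw [fromBlocks_multiply, fromBlocks_multiply]
  congr 1 <;> ext i j <;> simp

theorem IsDoubled.one [DecidableEq α] : IsDoubled (1 : Matrix (α ⊕ α) (α ⊕ α) ℂ) := by
  refine ⟨1, 0, ?_⟩
  unfold Delta
  rw [← fromBlocks_one]
  congr 1
  · ext i j; simp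
  · ext i j; simp [Matrix.one_apply, apply_ite]

theorem IsDoubled.submatrix {δ : Type*} {X : Matrix (α ⊕ α) (β ⊕ β) ℂ} (hX : IsDoubled X)
    (f : γ → α) (g : δ → β) : IsDoubled (X.submatrix (Sum.map f f) (Sum.map g g)) := by
  obtain ⟨A, B, rfl⟩ := hX
  refine ⟨A.submatrix f g, B.submatrix f g, ?_⟩
  ext (i | i) (j | j) <;> simp [Delta]

theorem IsDoubled.smul_Jmat_mul [Fintype α] [DecidableEq α] {X : Matrix (α ⊕ α) (β ⊕ β) ℂ}
    (hX : IsDoubled X) (r : ℝ) : IsDoubled ((r * Complex.I : ℂ) • (Jmat α * X)) := by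
  obtain ⟨A, B, rfl⟩ := hX
  refine ⟨(r * Complex.I : ℂ) • A, (r * Complex.I : ℂ) • B, ?_⟩
  unfold Delta Jmat
  rw [fromBlocks_multiply, fromBlocks_smul]
  congr 1 <;> ext i j <;> simp

theorem Jmat_mul_Jmat [Fintype α] [DecidableEq α] : Jmat α * Jmat α = 1 := by
  unfold Jmat
  rw [fromBlocks_multiply, ← fromBlocks_one]
  simp

theorem Jmat_conjTranspose [DecidableEq α] : (Jmat α)ᴴ = Jmat α := by
  unfold Jmat
  rw [fromBlocks_conjTranspose]
  simp

theorem flat_mul [Fintype α] [DecidableEq α] [Fintype β] [DecidableEq β] [Fintype γ]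
    [DecidableEq γ] (X : Matrix (α ⊕ α) (β ⊕ β) ℂ) (Y : Matrix (β ⊕ β) (γ ⊕ γ) ℂ) :
    flat (X * Y) = flat Y * flat X := by
  unfold flat
  rw [conjTranspose_mul]
  have h : Jmat β * (Jmat β * (Xᴴ * Jmat α)) = Xᴴ * Jmat α := by
    rw [← Matrix.mul_assoc, Jmat_mul_Jmat, Matrix.one_mul]
  simp only [Matrix.mul_assoc]
  rw [h]

theorem flat_flat [Fintype α] [DecidableEq α] [Fintype β] [DecidableEq β]
    (X : Matrix (α ⊕ α) (β ⊕ β) ℂ) : flat (flat X) = X := by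
  unfold flat
  rw [conjTranspose_mul, conjTranspose_mul, conjTranspose_conjTranspose, Jmat_conjTranspose,
    Jmat_conjTranspose]
  calc Jmat α * (Jmat α * (X * Jmat β)) * Jmat β = (Jmat α * Jmat α) * X * (Jmat β * Jmat β) := by
        simp only [Matrix.mul_assoc]
    _ = X := by rw [Jmat_mul_Jmat, Jmat_mul_Jmat]; simp

theorem IsSymplectic.one [Fintype α] [DecidableEq α] :
    IsSymplectic (1 : Matrix (α ⊕ α) (α ⊕ α) ℂ) where
  doubled := IsDoubled.one
  flat_mul := by simp [QuantumLinear.flat, Jmat_mul_Jmat]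
  mul_flat := by simp [QuantumLinear.flat, Jmat_mul_Jmat]

theorem IsSymplectic.flat [Fintype α] [DecidableEq α] {T : Matrix (α ⊕ α) (α ⊕ α) ℂ}
    (hT : IsSymplectic T) : IsSymplectic (flat T) where
  doubled := hT.doubled.flat
  flat_mul := by rw [flat_flat]; exact hT.mul_flat
  mul_flat := by rw [flat_flat]; exact hT.flat_mul

theorem IsSymplectic.mul [Fintype α] [DecidableEq α] {T U : Matrix (α ⊕ α) (α ⊕ α) ℂ}
    (hT : IsSymplectic T) (hU : IsSymplectic U) : IsSymplectic (T * U) where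
  doubled := hT.doubled.mul hU.doubled
  flat_mul := by
    rw [QuantumLinear.flat_mul]
    calc QuantumLinear.flat U * QuantumLinear.flat T * (T * U)
        = QuantumLinear.flat U * (QuantumLinear.flat T * T) * U := by
          simp only [Matrix.mul_assoc]
      _ = 1 := by rw [hT.flat_mul, Matrix.mul_one, hU.flat_mul]
  mul_flat := by
    rw [QuantumLinear.flat_mul]
    calc T * U * (QuantumLinear.flat U * QuantumLinear.flat T)
        = T * (U * QuantumLinear.flat U) * QuantumLinear.flat T := by
          simp only [Matrix.mul_assoc]
      _ = 1 := by rw [hU.mul_flat, Matrix.mul_one, hT.mul_flat]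

end helpers

end QuantumLinear

open QuantumLinear

/-- A quantum linear system `(S, C, Ω)` with modes indexed by `ι` and input channels indexed by
`κ`: `S` is the symplectic static scattering/squeezing matrix, `C = Δ(C₋, C₊)` the coupling and
`Ω = Δ(Ω₋, Ω₊)` the Hamiltonian matrix. That `Ω` is Hermitian amounts to `Ω₋† = Ω₋` and
`Ω₊ᵀ = Ω₊`. -/
@[ext]
structure QLS (ι κ : Type*) [Fintype κ] [DecidableEq κ] where
  S : Matrix (κ ⊕ κ) (κ ⊕ κ) ℂ
  C : Matrix (κ ⊕ κ) (ι ⊕ ι) ℂ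
  Ω : Matrix (ι ⊕ ι) (ι ⊕ ι) ℂ
  symplectic_S : IsSymplectic S
  doubled_C : IsDoubled C
  doubled_Ω : IsDoubled Ω
  hermitian_Ω : Ω.IsHermitian

namespace QLS

variable {ι ι' ι₁ ι₂ κ : Type*} [Fintype ι] [DecidableEq ι] [Fintype ι'] [DecidableEq ι']
  [Fintype ι₁] [DecidableEq ι₁] [Fintype ι₂] [DecidableEq ι₂] [Fintype κ] [DecidableEq κ]

/-- The drift matrix `A = -½ C^♭ C - i J Ω`. -/
def A (G : QLS ι κ) : Matrix (ι ⊕ ι) (ι ⊕ ι) ℂ :=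
  -((1 / 2 : ℂ) • (flat G.C * G.C)) - Complex.I • (Jmat ι * G.Ω)

/-- Hurwitz stability: all eigenvalues of `A` have strictly negative real part. -/
def IsHurwitz (G : QLS ι κ) : Prop :=
  ∀ z ∈ spectrum ℂ G.A, z.re < 0

/-- `s` is not an eigenvalue of `A`. -/
def IsRegularAt (G : QLS ι κ) (s : ℂ) : Prop :=
  IsUnit (s • (1 : Matrix (ι ⊕ ι) (ι ⊕ ι) ℂ) - G.A)

/-- The transfer function `Ξ(s) = (1 - C (s - A)⁻¹ C^♭) S` (meaningful at regular points). -/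
def transfer (G : QLS ι κ) (s : ℂ) : Matrix (κ ⊕ κ) (κ ⊕ κ) ℂ :=
  (1 - G.C * (s • (1 : Matrix (ι ⊕ ι) (ι ⊕ ι) ℂ) - G.A)⁻¹ * flat G.C) * G.S

/-- The power spectrum `Ψ_V(s) = Ξ(s) V Ξ(-s^#)†`
(meaningful where `s` and `-s^#` are regular points). -/
def powerSpectrum (G : QLS ι κ) (V : Matrix (κ ⊕ κ) (κ ⊕ κ) ℂ) (s : ℂ) :
    Matrix (κ ⊕ κ) (κ ⊕ κ) ℂ :=
  G.transfer s * V * (G.transfer (-star s))ᴴ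

/-- Two systems have the same power spectrum: the rational functions `Ψ_V` agree wherever both
are defined by their formula. -/
def SamePowerSpectrum (G : QLS ι κ) (G' : QLS ι' κ) (V : Matrix (κ ⊕ κ) (κ ⊕ κ) ℂ) : Prop :=
  ∀ s : ℂ, G.IsRegularAt s → G.IsRegularAt (-star s) → G'.IsRegularAt s →
    G'.IsRegularAt (-star s) → G.powerSpectrum V s = G'.powerSpectrum V s

/-- Global minimality for the input covariance `V`: no (Hurwitz) system with fewer modes has the
same power spectrum. -/
def IsGloballyMinimal (G : QLS ι κ) (V : Matrix (κ ⊕ κ) (κ ⊕ κ) ℂ) : Prop :=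
  ∀ k : ℕ, k < Fintype.card ι → ∀ G' : QLS (Fin k) κ, G'.IsHurwitz →
    ¬ SamePowerSpectrum G G' V

/-- The Lyapunov equation for the stationary covariance of the system modes. The static
component `S` acts on the input before the modes do, so these see the input covariance
`S V S†`. -/
def Lyapunov (G : QLS ι κ) (V : Matrix (κ ⊕ κ) (κ ⊕ κ) ℂ) (P : Matrix (ι ⊕ ι) (ι ⊕ ι) ℂ) :
    Prop :=
  G.A * P + P * G.Aᴴ + flat G.C * (G.S * V * G.Sᴴ) * (flat G.C)ᴴ = 0

/-- Passivity: no annihilation-creation mixing in `S`, `C` or `Ω`. -/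
def IsPassive (G : QLS ι κ) : Prop :=
  G.S.toBlocks₁₂ = 0 ∧ G.C.toBlocks₁₂ = 0 ∧ G.Ω.toBlocks₁₂ = 0

/-- The same system in mode coordinates `ă' = T ă`: `C' = C T^♭` and `J Ω' = T J Ω T^♭`. -/
def changeBasis (G : QLS ι κ) {T : Matrix (ι ⊕ ι) (ι ⊕ ι) ℂ} (hT : IsSymplectic T) :
    QLS ι κ where
  S := G.S
  C := G.C * flat T
  Ω := (flat T)ᴴ * G.Ω * flat T
  symplectic_S := G.symplectic_S
  doubled_C := G.doubled_C.mul hT.doubled.flat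
  doubled_Ω := (hT.doubled.flat.conjTranspose.mul G.doubled_Ω).mul hT.doubled.flat
  hermitian_Ω := isHermitian_conjTranspose_mul_mul _ G.hermitian_Ω

/-- The same system in field coordinates `b̆' = R b̆` (for input and output):
`S' = R S R^♭` and `C' = R C`. -/
def changeField (G : QLS ι κ) {R : Matrix (κ ⊕ κ) (κ ⊕ κ) ℂ} (hR : IsSymplectic R) :
    QLS ι κ where
  S := R * G.S * flat R
  C := R * G.C
  Ω := G.Ω
  symplectic_S := (hR.mul G.symplectic_S).mul hR.flat
  doubled_C := hR.doubled.mul G.doubled_C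
  doubled_Ω := G.doubled_Ω
  hermitian_Ω := G.hermitian_Ω

/-- Restriction of a system to the modes selected by `f` (a relabelling of the modes if `f` is
bijective). -/
def restrict (G : QLS ι κ) (f : ι' → ι) : QLS ι' κ where
  S := G.S
  C := G.C.submatrix (Sum.map id id) (Sum.map f f)
  Ω := G.Ω.submatrix (Sum.map f f) (Sum.map f f)
  symplectic_S := G.symplectic_S
  doubled_C := G.doubled_C.submatrix id f
  doubled_Ω := G.doubled_Ω.submatrix f f
  hermitian_Ω := G.hermitian_Ω.submatrix _

/-- Moves the static component from the input to the output of the modes and removes it there: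
`(S, C, Ω)` becomes `(1, S^♭ C, Ω)`, so that `Ξ(s) = S Ξ'(s)`. -/
def dropStatic (G : QLS ι κ) : QLS ι κ where
  S := 1
  C := flat G.S * G.C
  Ω := G.Ω
  symplectic_S := IsSymplectic.one
  doubled_C := G.symplectic_S.doubled.flat.mul G.doubled_C
  doubled_Ω := G.doubled_Ω
  hermitian_Ω := G.hermitian_Ω

/-- Doubled-up coordinate projection onto the modes `ι₁` of `ι₁ ⊕ ι₂`: `X * padL ι₁ ι₂` pads `X`
with zero columns. -/
def padL (ι₁ ι₂ : Type*) [DecidableEq ι₁] [DecidableEq ι₂] :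
    Matrix (ι₁ ⊕ ι₁) ((ι₁ ⊕ ι₂) ⊕ (ι₁ ⊕ ι₂)) ℂ :=
  (1 : Matrix ((ι₁ ⊕ ι₂) ⊕ (ι₁ ⊕ ι₂)) ((ι₁ ⊕ ι₂) ⊕ (ι₁ ⊕ ι₂)) ℂ).submatrix
    (Sum.map Sum.inl Sum.inl) (Sum.map id id)

/-- Doubled-up coordinate projection onto the modes `ι₂` of `ι₁ ⊕ ι₂`. -/
def padR (ι₁ ι₂ : Type*) [DecidableEq ι₁] [DecidableEq ι₂] :
    Matrix (ι₂ ⊕ ι₂) ((ι₁ ⊕ ι₂) ⊕ (ι₁ ⊕ ι₂)) ℂ :=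
  (1 : Matrix ((ι₁ ⊕ ι₂) ⊕ (ι₁ ⊕ ι₂)) ((ι₁ ⊕ ι₂) ⊕ (ι₁ ⊕ ι₂)) ℂ).submatrix
    (Sum.map Sum.inr Sum.inr) (Sum.map id id)

/-- `Im_♭ X = (X - X^♭) / 2i`. -/
def imFlat (X : Matrix (ι ⊕ ι) (ι ⊕ ι) ℂ) : Matrix (ι ⊕ ι) (ι ⊕ ι) ℂ :=
  (1 / (2 * Complex.I) : ℂ) • (X - flat X)

/-- The series product `G₂ ◁ G₁` (the output of `G₁` is fed into `G₂`):
`S = S₂ S₁`, `C = S₂ C̃₁ + C̃₂`, `J Ω = J Ω̃₁ + J Ω̃₂ + Im_♭ (C̃₂^♭ S₂ C̃₁)`, where the tilde denotes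
padding by zero blocks. -/
def series (G₂ : QLS ι₂ κ) (G₁ : QLS ι₁ κ) : QLS (ι₁ ⊕ ι₂) κ where
  S := G₂.S * G₁.S
  C := G₂.S * (G₁.C * padL ι₁ ι₂) + G₂.C * padR ι₁ ι₂
  Ω := (padL ι₁ ι₂)ᴴ * G₁.Ω * padL ι₁ ι₂ + (padR ι₁ ι₂)ᴴ * G₂.Ω * padR ι₁ ι₂
    + Jmat (ι₁ ⊕ ι₂) * imFlat (flat (G₂.C * padR ι₁ ι₂) * (G₂.S * (G₁.C * padL ι₁ ι₂)))
  symplectic_S := G₂.symplectic_S.mul G₁.symplectic_S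
  doubled_C := by
    have h1 : IsDoubled (padL ι₁ ι₂) := IsDoubled.one.submatrix _ _
    have h2 : IsDoubled (padR ι₁ ι₂) := IsDoubled.one.submatrix _ _
    exact (G₂.symplectic_S.doubled.mul (G₁.doubled_C.mul h1)).add (G₂.doubled_C.mul h2)
  doubled_Ω := by
    have h1 : IsDoubled (padL ι₁ ι₂) := IsDoubled.one.submatrix _ _
    have h2 : IsDoubled (padR ι₁ ι₂) := IsDoubled.one.submatrix _ _
    have hX : IsDoubled (QuantumLinear.flat (G₂.C * padR ι₁ ι₂) *
        (G₂.S * (G₁.C * padL ι₁ ι₂))) :=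
      (G₂.doubled_C.mul h2).flat.mul (G₂.symplectic_S.doubled.mul (G₁.doubled_C.mul h1))
    refine (((h1.conjTranspose.mul G₁.doubled_Ω).mul h1).add
      ((h2.conjTranspose.mul G₂.doubled_Ω).mul h2)).add ?_
    have h := (hX.sub hX.flat).smul_Jmat_mul (-(1 / 2))
    have hc : (1 / (2 * Complex.I) : ℂ) = ((-(1 / 2) : ℝ) : ℂ) * Complex.I := by
      rw [one_div, mul_inv, Complex.inv_I]; push_cast; ring
    unfold imFlat
    rw [Matrix.mul_smul, hc]
    exact h
  hermitian_Ω := by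
    refine ((isHermitian_conjTranspose_mul_mul _ G₁.hermitian_Ω).add
      (isHermitian_conjTranspose_mul_mul _ G₂.hermitian_Ω)).add ?_
    generalize QuantumLinear.flat (G₂.C * padR ι₁ ι₂) *
        (G₂.S * (G₁.C * padL ι₁ ι₂)) = X
    have hs : star (1 / (2 * Complex.I) : ℂ) = -(1 / (2 * Complex.I)) := by
      rw [one_div]
      simp [Complex.inv_I]
    have hJ : Jmat (ι₁ ⊕ ι₂) * (X - QuantumLinear.flat X)
        = Jmat (ι₁ ⊕ ι₂) * X - Xᴴ * Jmat (ι₁ ⊕ ι₂) := by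
      unfold QuantumLinear.flat
      rw [Matrix.mul_sub, ← Matrix.mul_assoc, ← Matrix.mul_assoc, Jmat_mul_Jmat, Matrix.one_mul]
    unfold imFlat Matrix.IsHermitian
    rw [Matrix.mul_smul, hJ, conjTranspose_smul, hs, conjTranspose_sub, conjTranspose_mul,
      conjTranspose_mul, Jmat_conjTranspose, conjTranspose_conjTranspose, neg_smul, ← smul_neg,
      neg_sub]

/-- The mixed component, for canonical modes with photon numbers `ν`: the restriction of the
system to the modes with `ν i ≠ 0`. -/
def mixedPart {P T : Matrix (ι ⊕ ι) (ι ⊕ ι) ℂ} {ν : ι → ℝ} (G : QLS ι κ)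
    (h : IsCanonicalBasis P T ν) : QLS {i // ¬ ν i = 0} κ :=
  (G.changeBasis h.symplectic).restrict Subtype.val

/-- The pure component: the restriction of the system to the modes with `ν i = 0`. The static
component is carried by the mixed part; for `S = 1` the `dropStatic` has no effect. -/
def purePart {P T : Matrix (ι ⊕ ι) (ι ⊕ ι) ℂ} {ν : ι → ℝ} (G : QLS ι κ)
    (h : IsCanonicalBasis P T ν) : QLS {i // ν i = 0} κ :=
  ((G.changeBasis h.symplectic).restrict Subtype.val).dropStatic

end QLS

end

open QuantumLinear

/-! Write `W = S V S†` and `K = P C† - C^♭ W`. The Lyapunov equation splits the power spectrum into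
partial fractions, `Ψ_V(s) = W + C (s - A)⁻¹ K - K† (s + A†)⁻¹ C†` (`powerSpectrum_eq`). The poles
of the two fractions lie in opposite half planes, so `Ψ_V` determines the Markov parameters `C Aʲ K`
of the stable part (`stable_markov_eq_of_eventually_eq`). Global minimality thus becomes a question
about minimal realizations.

If `P` is invertible, `(A, K, C)` is minimal. Observability follows from `A + A^♭ + C^♭ C = 0` and
stability alone. Controllability also uses the Lyapunov equation and `P - conjSwap P = J`
(`eq_zero_of_eigenvector_of_invertible_cov`). Any system with the same spectrum then has at least as
many states (`card_le_of_markov_eq`).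

If `ν i = 0` in a canonical basis, the creation coordinate of mode `i` has variance zero. In vacuum
field coordinates the noise term of the Lyapunov equation is `X X†`, so its vanishing diagonal entry
kills a whole row of `X` (`Lyapunov.noise_row_eq_zero`), and the rest of that row of the equation
then kills drift entries. Hence the mixed modes do not drive the pure ones
(`Lyapunov.drift_pure_mixed`), the pure modes couple passively, and their rows of `K` vanish
(`Lyapunov.input_row_eq_zero`). Deleting them keeps the power spectrum, and what remains has
invertible covariance, so it is minimal. The triangular drift fixes the off-diagonal blocks of `Ω`,
and these are the interaction term of the series product (`eq_series_of_drift_eq_zero`).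

Canonical bases come from Williamson's theorem. Its hypotheses `P ≥ 0` and `P - conjSwap P = J` are
inherited from the input covariance through stability. -/

namespace QuantumLinear

open scoped ComplexOrder

/-! ### Stable matrices: Sylvester and Lyapunov equations, positivity. -/

section StableMatrices

variable {a b : Type*} [Fintype a] [DecidableEq a] [Fintype b] [DecidableEq b]

/-- All eigenvalues have strictly negative real part. -/
def IsStable (A : Matrix a a ℂ) : Prop :=
  ∀ z ∈ spectrum ℂ A, z.re < 0

theorem mem_spectrum_iff_exists_eigenvector {A : Matrix a a ℂ} {z : ℂ} :
    z ∈ spectrum ℂ A ↔ ∃ x ≠ 0, A *ᵥ x = z • x := by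
  rw [spectrum.mem_iff, Matrix.isUnit_iff_isUnit_det, isUnit_iff_ne_zero, not_not,
    ← Matrix.exists_mulVec_eq_zero_iff]
  refine exists_congr fun x => and_congr_right fun _ => ?_
  rw [Matrix.sub_mulVec, Matrix.algebraMap_eq_diagonal]
  simp only [Pi.algebraMap_def, Algebra.algebraMap_self, RingHom.id_apply]
  rw [show (diagonal fun _ : a => z) *ᵥ x = z • x by
    ext i; simp [Matrix.mulVec_diagonal], sub_eq_zero, eq_comm]

theorem mem_spectrum_conjTranspose {A : Matrix a a ℂ} {z : ℂ} :
    z ∈ spectrum ℂ Aᴴ ↔ star z ∈ spectrum ℂ A := by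
  rw [← star_eq_conjTranspose, spectrum.map_star, Set.mem_star]

theorem mem_spectrum_neg {A : Matrix a a ℂ} {z : ℂ} :
    z ∈ spectrum ℂ (-A) ↔ -z ∈ spectrum ℂ A := by
  rw [← spectrum.neg_eq, Set.mem_neg]

/-- Two matrices without a common eigenvalue are separated by a polynomial. -/
theorem exists_polynomial_aeval_eq_one_aeval_eq_zero {c d : Type*} [Fintype c] [DecidableEq c]
    [Fintype d] [DecidableEq d]
    {A : Matrix a a ℂ} {A' : Matrix b b ℂ} {B : Matrix c c ℂ} {B' : Matrix d d ℂ}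
    (h₁ : ∀ z ∈ spectrum ℂ A, z.re < 0) (h₂ : ∀ z ∈ spectrum ℂ A', z.re < 0)
    (h₃ : ∀ z ∈ spectrum ℂ B, 0 < z.re) (h₄ : ∀ z ∈ spectrum ℂ B', 0 < z.re) :
    ∃ p : Polynomial ℂ, Polynomial.aeval A p = 1 ∧ Polynomial.aeval A' p = 1 ∧
      Polynomial.aeval B p = 0 ∧ Polynomial.aeval B' p = 0 := by
  have hc : IsCoprime (A.charpoly * A'.charpoly) (B.charpoly * B'.charpoly) := by
    rw [Polynomial.isCoprime_iff_aeval_ne_zero_of_isAlgClosed ℂ ℂ]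
    intro z
    by_contra! h
    simp only [Polynomial.coe_aeval_eq_eval, Polynomial.eval_mul, mul_eq_zero] at h
    have hl : z.re < 0 := by
      rcases h.1 with h | h
      · exact h₁ z (Matrix.mem_spectrum_iff_isRoot_charpoly.2 h)
      · exact h₂ z (Matrix.mem_spectrum_iff_isRoot_charpoly.2 h)
    have hr : 0 < z.re := by
      rcases h.2 with h | h
      · exact h₃ z (Matrix.mem_spectrum_iff_isRoot_charpoly.2 h)
      · exact h₄ z (Matrix.mem_spectrum_iff_isRoot_charpoly.2 h)
    exact hl.not_gt hr
  obtain ⟨u, v, huv⟩ := hc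
  -- By Cayley–Hamilton the other Bézout summand vanishes at `A` and `A'`, so this one is `1` there;
  -- it vanishes itself at `B` and `B'`.
  refine ⟨v * (B.charpoly * B'.charpoly), ?_, ?_, ?_, ?_⟩
  · have := congrArg (Polynomial.aeval A) huv
    simpa [Matrix.aeval_self_charpoly] using this
  · have := congrArg (Polynomial.aeval A') huv
    simpa [Matrix.aeval_self_charpoly] using this
  · simp [Matrix.aeval_self_charpoly]
  · simp [Matrix.aeval_self_charpoly]

theorem aeval_mul_eq_mul_aeval {A : Matrix a a ℂ} {B : Matrix b b ℂ} {X : Matrix a b ℂ}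
    (h : A * X = X * B) (p : Polynomial ℂ) :
    Polynomial.aeval A p * X = X * Polynomial.aeval B p := by
  induction p using Polynomial.induction_on' with
  | add p q hp hq => simp [Matrix.add_mul, Matrix.mul_add, hp, hq]
  | monomial k r =>
    have hk : A ^ k * X = X * B ^ k := by
      induction k with
      | zero => simp
      | succ k ih => rw [pow_succ, Matrix.mul_assoc, h, ← Matrix.mul_assoc, ih, Matrix.mul_assoc,
          ← pow_succ]
    simp [Polynomial.aeval_monomial, Algebra.algebraMap_eq_smul_one, hk]

/-- A homogeneous Sylvester equation with separated spectra has only the trivial solution. -/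
theorem eq_zero_of_mul_add_mul_eq_zero {A : Matrix a a ℂ} {B : Matrix b b ℂ} {X : Matrix a b ℂ}
    (hA : IsStable A) (hB : IsStable B) (h : A * X + X * B = 0) : X = 0 := by
  have hB' : ∀ z ∈ spectrum ℂ (-B), 0 < z.re := fun z hz => by
    simpa using hB _ (mem_spectrum_neg.1 hz)
  obtain ⟨p, hp, -, hq, -⟩ := exists_polynomial_aeval_eq_one_aeval_eq_zero hA hA hB' hB'
  have h' : A * X = X * (-B) := by rw [Matrix.mul_neg]; exact eq_neg_of_add_eq_zero_left h
  -- `X` intertwines `A` with `-B`, hence `p(A) X = X p(-B)`; the left side is `X` and the right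
  -- side is `0`.
  simpa [hp, hq] using aeval_mul_eq_mul_aeval h' p

theorem IsStable.conjTranspose {A : Matrix a a ℂ} (hA : IsStable A) : IsStable Aᴴ :=
  fun z hz => by simpa using hA _ (mem_spectrum_conjTranspose.1 hz)

theorem IsStable.lyapunov_unique {A X : Matrix a a ℂ} (hA : IsStable A)
    (h : A * X + X * Aᴴ = 0) : X = 0 :=
  eq_zero_of_mul_add_mul_eq_zero hA hA.conjTranspose h

/-- Uniqueness makes `P ↦ A P + P A†` injective, hence surjective in finite dimension. -/
theorem IsStable.exists_lyapunov {A : Matrix a a ℂ} (hA : IsStable A) (Q : Matrix a a ℂ) :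
    ∃ P, A * P + P * Aᴴ + Q = 0 := by
  let f : Matrix a a ℂ →ₗ[ℂ] Matrix a a ℂ :=
    LinearMap.mulLeft ℂ A + LinearMap.mulRight ℂ Aᴴ
  have hf : Function.Injective f := by
    rw [← LinearMap.ker_eq_bot, LinearMap.ker_eq_bot']
    intro X hX
    exact hA.lyapunov_unique hX
  obtain ⟨P, hP⟩ := (LinearMap.injective_iff_surjective.1 hf) (-Q)
  refine ⟨P, ?_⟩
  rw [show A * P + P * Aᴴ = f P from rfl, hP, neg_add_cancel]

section powers

open Filter Topology

attribute [local instance] Matrix.linftyOpNormedRing Matrix.linftyOpNormedAlgebra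

/-- Gelfand's formula: the spectral radius is below some `r < 1`, so eventually `‖B ^ k‖ ≤ r ^ k`.
-/
theorem tendsto_pow_of_spectrum_lt_one {B : Matrix a a ℂ} (hB : ∀ z ∈ spectrum ℂ B, ‖z‖ < 1) :
    Tendsto (fun k => B ^ k) atTop (𝓝 0) := by
  cases isEmpty_or_nonempty a
  · exact tendsto_const_nhds.congr fun _ => Subsingleton.elim _ _
  have hr : spectralRadius ℂ B < ((1 : NNReal) : ENNReal) :=
    spectrum.spectralRadius_lt_of_forall_lt B fun z hz => hB z hz
  obtain ⟨r, hr1, hr2⟩ := exists_between hr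
  lift r to NNReal using (hr2.trans ENNReal.one_lt_top).ne
  have hev := (spectrum.pow_nnnorm_pow_one_div_tendsto_nhds_spectralRadius B).eventually_lt_const
    hr1
  refine tendsto_zero_iff_norm_tendsto_zero.2 ?_
  have hr2' : r < 1 := by exact_mod_cast hr2
  refine squeeze_zero' (Eventually.of_forall fun _ => norm_nonneg _) ?_
    (tendsto_pow_atTop_nhds_zero_of_lt_one r.coe_nonneg (by exact_mod_cast hr2'))
  filter_upwards [hev, eventually_gt_atTop 0] with k hk hk0
  have hk' : (‖B ^ k‖₊ : ENNReal) ≤ (r : ENNReal) ^ k := by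
    have h := ENNReal.rpow_le_rpow hk.le (Nat.cast_nonneg k : (0 : ℝ) ≤ k)
    rwa [← ENNReal.rpow_mul, one_div, inv_mul_cancel₀ (by positivity), ENNReal.rpow_one,
      ENNReal.rpow_natCast] at h
  exact_mod_cast hk'

theorem tendsto_resolvent (A : Matrix a a ℂ) :
    Tendsto (fun s : ℂ => (s • (1 : Matrix a a ℂ) - A)⁻¹) (Bornology.cobounded ℂ) (𝓝 0) := by
  have h := spectrum.resolvent_tendsto_cobounded (𝕜 := ℂ) A
  refine h.congr fun s => ?_
  rw [resolvent, Algebra.algebraMap_eq_smul_one, nonsing_inv_eq_ringInverse]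

end powers

/-- The solution of a discrete Lyapunov equation with positive data is positive. -/
theorem posSemidef_of_sub_posSemidef {B P Q : Matrix a a ℂ} (hB : ∀ z ∈ spectrum ℂ B, ‖z‖ < 1)
    (hP : P.IsHermitian) (hQ : Q.PosSemidef) (h : P - B * P * Bᴴ = Q) : P.PosSemidef := by
  have hk : ∀ k : ℕ, (P - B ^ k * P * (B ^ k)ᴴ).PosSemidef := by
    intro k
    induction k with
    | zero => simpa using PosSemidef.zero
    | succ k ih =>
      have := (hQ.mul_mul_conjTranspose_same (B ^ k)).add ih
      convert this using 1
      rw [← h, pow_succ, conjTranspose_mul]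
      noncomm_ring
  refine PosSemidef.of_dotProduct_mulVec_nonneg hP fun x => ?_
  have ht := tendsto_pow_of_spectrum_lt_one hB
  have hc : Continuous fun Y : Matrix a a ℂ => star x ⬝ᵥ ((P - Y * P * Yᴴ) *ᵥ x) := by fun_prop
  have hlim := (hc.tendsto 0).comp ht
  simp only [Matrix.zero_mul, sub_zero] at hlim
  exact ge_of_tendsto' hlim fun k => (hk k).dotProduct_mulVec_nonneg x

/-- The solution of a Lyapunov equation with positive data is positive. -/
theorem IsStable.posSemidef {A P Q : Matrix a a ℂ} (hA : IsStable A) (hQ : Q.PosSemidef)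
    (h : A * P + P * Aᴴ + Q = 0) : P.PosSemidef := by
  have hP : P.IsHermitian := by
    have h2 : A * (Pᴴ - P) + (Pᴴ - P) * Aᴴ = 0 := by
      have h3 := congrArg Matrix.conjTranspose h
      simp only [conjTranspose_add, conjTranspose_mul, conjTranspose_conjTranspose,
        conjTranspose_zero, hQ.isHermitian.eq] at h3
      have h4 : A * (Pᴴ - P) + (Pᴴ - P) * Aᴴ
          = (Pᴴ * Aᴴ + A * Pᴴ + Q) - (A * P + P * Aᴴ + Q) := by noncomm_ring
      rw [h4, h, h3, sub_self]
    exact sub_eq_zero.1 (hA.lyapunov_unique h2)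
  have hu : IsUnit (1 - A) := by
    by_contra hu
    have : (1 : ℂ) ∈ spectrum ℂ A := by rwa [spectrum.mem_iff, map_one]
    have := hA 1 this
    norm_num at this
  have hdet := (Matrix.isUnit_iff_isUnit_det _).1 hu
  -- The Cayley transform `(1 - A)⁻¹ (1 + A)` carries the left half plane into the unit disc and
  -- turns the Lyapunov equation into its discrete form with data `2 R Q R†`.
  set R := (1 - A)⁻¹ with hR
  have hR1 : R * (1 - A) = 1 := nonsing_inv_mul _ hdet
  have hR2 : (1 - A)ᴴ * Rᴴ = 1 := by rw [← conjTranspose_mul, hR1, conjTranspose_one]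
  have hB : ∀ z ∈ spectrum ℂ (R * (1 + A)), ‖z‖ < 1 := by
    intro z hz
    obtain ⟨x, hx, hxz⟩ := mem_spectrum_iff_exists_eigenvector.1 hz
    have h1 : (1 + A) *ᵥ x = z • ((1 - A) *ᵥ x) := by
      have := congrArg ((1 - A) *ᵥ ·) hxz
      simpa [mulVec_mulVec, ← Matrix.mul_assoc, mul_nonsing_inv _ hdet, hR, mulVec_smul]
        using this
    have h2 : (1 + z) • (A *ᵥ x) = (z - 1) • x := by
      rw [add_mulVec, sub_mulVec, one_mulVec, smul_sub] at h1
      rw [add_smul, sub_smul, one_smul, one_smul]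
      linear_combination (exp := 1) h1
    have hz1 : 1 + z ≠ 0 := by
      intro h0
      rw [h0, zero_smul, show z - 1 = -2 by linear_combination h0] at h2
      exact hx ((smul_eq_zero.1 h2.symm).resolve_left (by norm_num))
    have h3 : A *ᵥ x = ((z - 1) / (1 + z)) • x := by
      rw [div_eq_inv_mul, mul_smul, ← h2, smul_smul, inv_mul_cancel₀ hz1, one_smul]
    have h4 := hA _ (mem_spectrum_iff_exists_eigenvector.2 ⟨x, hx, h3⟩)
    have h5 : ((z - 1) / (1 + z)).re = (‖z‖ ^ 2 - 1) / Complex.normSq (1 + z) := by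
      rw [Complex.div_re, ← Complex.normSq_eq_norm_sq, Complex.normSq_apply z, ← add_div]
      simp
      ring
    rw [h5, div_neg_iff] at h4
    have h6 := Complex.normSq_pos.2 hz1
    have h7 : ‖z‖ ^ 2 - 1 < 0 := by
      rcases h4 with h4 | h4
      · exact absurd h4.2 h6.not_gt
      · exact h4.1
    nlinarith [norm_nonneg z]
  refine posSemidef_of_sub_posSemidef hB hP
    ((hQ.mul_mul_conjTranspose_same R).smul (show (0 : ℂ) ≤ 2 by norm_num)) ?_
  have h6 : (1 - A) * P * (1 - A)ᴴ - (1 + A) * P * (1 + A)ᴴ = (2 : ℂ) • Q := by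
    have : Q = -(A * P + P * Aᴴ) := eq_neg_of_add_eq_zero_right h
    rw [this, conjTranspose_sub, conjTranspose_add, conjTranspose_one, two_smul]
    noncomm_ring
  calc P - R * (1 + A) * P * (R * (1 + A))ᴴ
      = R * (1 - A) * P * ((1 - A)ᴴ * Rᴴ) - R * (1 + A) * P * (R * (1 + A))ᴴ := by
        rw [hR1, hR2, Matrix.one_mul, Matrix.mul_one]
    _ = R * ((1 - A) * P * (1 - A)ᴴ - (1 + A) * P * (1 + A)ᴴ) * Rᴴ := by
        rw [conjTranspose_mul]; noncomm_ring
    _ = (2 : ℂ) • (R * Q * Rᴴ) := by rw [h6]; simp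

end StableMatrices

end QuantumLinear

namespace QuantumLinear

open scoped ComplexOrder MatrixOrder

/-! ### The conjugation symmetry of doubled-up matrices. -/

section ConjSwap

variable {α β γ : Type*}

/-- `Σ X^# Σ`, where `Σ` exchanges the two halves of the doubled-up coordinates. -/
def conjSwap (X : Matrix (α ⊕ α) (β ⊕ β) ℂ) : Matrix (α ⊕ α) (β ⊕ β) ℂ :=
  (X.submatrix Sum.swap Sum.swap).map star

/-- Doubled-up matrices become the fixed points of a multiplicative antilinear involution, so the
property can be handled by algebra instead of by blocks. -/
theorem isDoubled_iff_conjSwap_eq {X : Matrix (α ⊕ α) (β ⊕ β) ℂ} :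
    IsDoubled X ↔ conjSwap X = X := by
  constructor
  · rintro ⟨A, B, rfl⟩
    ext (i | i) (j | j) <;> simp [conjSwap, Delta]
  · intro h
    refine ⟨X.toBlocks₁₁, X.toBlocks₁₂, ?_⟩
    ext (i | i) (j | j)
    · simp [Delta, toBlocks₁₁]
    · simp [Delta, toBlocks₁₂]
    · conv_lhs => rw [← h]
      simp [Delta, conjSwap, toBlocks₁₂]
    · conv_lhs => rw [← h]
      simp [Delta, conjSwap, toBlocks₁₁]


theorem conjSwap_mul [Fintype β] (X : Matrix (α ⊕ α) (β ⊕ β) ℂ) (Y : Matrix (β ⊕ β) (γ ⊕ γ) ℂ) :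
    conjSwap (X * Y) = conjSwap X * conjSwap Y := by
  ext i j
  simp only [conjSwap, map_apply, submatrix_apply, mul_apply, star_sum, star_mul']
  exact (Fintype.sum_equiv (Equiv.sumComm β β) _ _ fun _ => rfl).symm

/-- The columns of `v`, conjugated and with the two halves of their coordinates exchanged. -/
def swapCols {κ : Type*} (v : Matrix (α ⊕ α) κ ℂ) : Matrix (α ⊕ α) κ ℂ :=
  (v.submatrix Sum.swap id).map star

theorem conjSwap_mul_swapCols [Fintype β] {κ : Type*} (X : Matrix (α ⊕ α) (β ⊕ β) ℂ)
    (v : Matrix (β ⊕ β) κ ℂ) : conjSwap X * swapCols v = swapCols (X * v) := by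
  ext i j
  simp only [conjSwap, swapCols, map_apply, submatrix_apply, mul_apply, star_sum, star_mul']
  exact Fintype.sum_equiv (Equiv.sumComm β β) _ _ fun _ => rfl

theorem swapCols_conjTranspose_mul [Fintype α] {κ κ' : Type*} (u : Matrix (α ⊕ α) κ ℂ)
    (v : Matrix (α ⊕ α) κ' ℂ) : (swapCols u)ᴴ * swapCols v = (uᴴ * v).map star := by
  ext i j
  simp only [swapCols, map_apply, submatrix_apply, mul_apply, star_sum, star_mul',
    conjTranspose_apply]
  exact Fintype.sum_equiv (Equiv.sumComm α α) _ _ fun _ => rfl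

theorem conjSwap_add (X Y : Matrix (α ⊕ α) (β ⊕ β) ℂ) :
    conjSwap (X + Y) = conjSwap X + conjSwap Y := by
  ext i j; simp [conjSwap]

theorem conjSwap_conjTranspose (X : Matrix (α ⊕ α) (β ⊕ β) ℂ) :
    conjSwap Xᴴ = (conjSwap X)ᴴ := by
  ext i j; simp [conjSwap]

theorem conjSwap_conjSwap (X : Matrix (α ⊕ α) (β ⊕ β) ℂ) : conjSwap (conjSwap X) = X := by
  ext i j; simp [conjSwap]

theorem conjSwap_zero : conjSwap (0 : Matrix (α ⊕ α) (β ⊕ β) ℂ) = 0 := by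
  ext i j; simp [conjSwap]

theorem conjSwap_Jmat [DecidableEq α] : conjSwap (Jmat α) = -Jmat α := by
  ext (i | i) (j | j) <;> simp [conjSwap, Jmat, Matrix.one_apply, apply_ite]

theorem conjSwap_posSemidef [Fintype α] {X : Matrix (α ⊕ α) (α ⊕ α) ℂ}
    (hX : X.PosSemidef) : (conjSwap X).PosSemidef := by
  have h : conjSwap X = (X.submatrix Sum.swap Sum.swap)ᵀ := by
    ext i j
    exact hX.isHermitian.apply _ _
  rw [h]
  exact (hX.submatrix Sum.swap).transpose

end ConjSwap

section Symplectic

variable {α : Type*} [Fintype α] [DecidableEq α] {T : Matrix (α ⊕ α) (α ⊕ α) ℂ}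

theorem IsSymplectic.conjSwap_eq (hT : IsSymplectic T) : conjSwap T = T :=
  isDoubled_iff_conjSwap_eq.1 hT.doubled

theorem Jmat_mul_cancel {β : Type*} (X : Matrix (α ⊕ α) β ℂ) : Jmat α * (Jmat α * X) = X := by
  rw [← Matrix.mul_assoc, Jmat_mul_Jmat, Matrix.one_mul]

theorem mul_Jmat_cancel {β : Type*} (X : Matrix β (α ⊕ α) ℂ) : X * Jmat α * Jmat α = X := by
  rw [Matrix.mul_assoc, Jmat_mul_Jmat, Matrix.mul_one]

theorem flat_conjTranspose {β : Type*} [Fintype β] [DecidableEq β]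
    (Z : Matrix (α ⊕ α) (β ⊕ β) ℂ) : (flat Z)ᴴ = Jmat α * Z * Jmat β := by
  simp [flat, Jmat_conjTranspose, Matrix.mul_assoc]

theorem IsSymplectic.mul_Jmat_mul_conjTranspose (hT : IsSymplectic T) :
    T * Jmat α * Tᴴ = Jmat α := by
  have h := congrArg (· * Jmat α) hT.mul_flat
  simpa [QuantumLinear.flat, Matrix.mul_assoc, Jmat_mul_Jmat] using h

theorem IsSymplectic.isUnit (hT : IsSymplectic T) : IsUnit T :=
  IsUnit.of_mul_eq_one _ hT.mul_flat

end Symplectic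

/-! ### Williamson normal form. -/

section Williamson

variable {α : Type*} [Fintype α] [DecidableEq α]

/-- Eigenvectors of `σ J` for positive eigenvalues `μ`, orthogonal for the form `J`, are completed
by their conjugates to a doubled-up frame in which `σ J` is `diag (μ, -μ)`. -/
theorem exists_doubled_frame {κ : Type*} [Fintype κ] [DecidableEq κ]
    {σ : Matrix (α ⊕ α) (α ⊕ α) ℂ} (hσ : σ.IsHermitian) (hc : conjSwap σ = σ)
    (w : Matrix (α ⊕ α) κ ℂ) (μ : κ → ℝ) (hμ : ∀ i, 0 < μ i)
    (hw : σ * Jmat α * w = w * diagonal fun i => (μ i : ℂ))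
    (ho : wᴴ * Jmat α * w = diagonal fun i => (μ i : ℂ)) :
    ∃ W : Matrix (α ⊕ α) (κ ⊕ κ) ℂ, IsDoubled W ∧ Wᴴ * Jmat α * W = Jmat κ ∧
      σ * Jmat α * W = W * fromBlocks (diagonal fun i => (μ i : ℂ)) 0 0
        (-diagonal fun i => (μ i : ℂ)) := by
  set D : Matrix κ κ ℂ := diagonal fun i => (μ i : ℂ) with hD
  set E : Matrix κ κ ℂ := diagonal fun i => (((√(μ i))⁻¹ : ℝ) : ℂ) with hE
  have hED : E * D = D * E := by simp [hE, hD, mul_comm]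
  have hEDE : Eᴴ * D * E = 1 := by
    rw [hE, hD, diagonal_conjTranspose, diagonal_mul_diagonal, diagonal_mul_diagonal,
      ← diagonal_one]
    congr 1
    ext i
    simp only [Pi.star_apply, RCLike.star_def, Complex.conj_ofReal]
    norm_cast
    have h := Real.mul_self_sqrt (hμ i).le
    have h0 : √(μ i) ≠ 0 := (Real.sqrt_pos.2 (hμ i)).ne'
    field_simp
    nlinarith
  set y : Matrix (α ⊕ α) κ ℂ := w * E with hy
  set z : Matrix (α ⊕ α) κ ℂ := swapCols y with hz
  have hyD : σ * Jmat α * y = y * D := by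
    rw [hy, ← Matrix.mul_assoc, hw, Matrix.mul_assoc, ← hED, Matrix.mul_assoc]
  have hyy : yᴴ * Jmat α * y = 1 := by
    rw [← hEDE, ← ho, hy, conjTranspose_mul]
    simp only [Matrix.mul_assoc]
  -- The conjugation fixes `σ` and negates `J`, so it sends eigenvectors of `σ J` for `μ` to
  -- eigenvectors for `-μ`.
  have hzD : σ * Jmat α * z = -(z * D) := by
    have h1 := conjSwap_mul_swapCols (σ * Jmat α) y
    rw [conjSwap_mul, hc, conjSwap_Jmat, Matrix.mul_neg, hyD, Matrix.neg_mul] at h1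
    rw [← neg_eq_iff_eq_neg, hz, h1]
    ext i j
    simp [swapCols, hD, mul_diagonal]
  have hzz : zᴴ * Jmat α * z = -1 := by
    have h1 := conjSwap_mul_swapCols (Jmat α) y
    rw [conjSwap_Jmat, Matrix.neg_mul, neg_eq_iff_eq_neg] at h1
    rw [Matrix.mul_assoc, hz, h1, Matrix.mul_neg, swapCols_conjTranspose_mul, ← Matrix.mul_assoc, hyy]
    ext i j
    simp [Matrix.one_apply, apply_ite]
  -- `σ J` is self-adjoint for the form `J`, and `μ i + μ j > 0` separates the eigenvalues `μ i` and
  -- `-μ j`.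
  have hyz : yᴴ * Jmat α * z = 0 := by
    have h1 : D * (yᴴ * Jmat α * z) = -(yᴴ * Jmat α * z * D) := by
      have h2 : yᴴ * Jmat α * σ = D * yᴴ := by
        have := congrArg Matrix.conjTranspose hyD
        simpa [Jmat_conjTranspose, hσ.eq, ← Matrix.mul_assoc, hD, diagonal_conjTranspose,
          Pi.star_def] using this
      calc D * (yᴴ * Jmat α * z) = yᴴ * Jmat α * (σ * Jmat α * z) := by
            rw [← Matrix.mul_assoc, ← Matrix.mul_assoc D, ← h2]; simp only [Matrix.mul_assoc]
        _ = _ := by rw [hzD, Matrix.mul_neg, Matrix.mul_assoc, Matrix.mul_assoc, Matrix.mul_assoc]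
    ext i j
    have h3 := congrFun (congrFun h1 i) j
    rw [hD, diagonal_mul, Matrix.neg_apply, mul_diagonal] at h3
    have h4 : ((μ i : ℂ) + μ j) * (yᴴ * Jmat α * z) i j = 0 := by linear_combination h3
    refine (mul_eq_zero.1 h4).resolve_left ?_
    exact_mod_cast (add_pos (hμ i) (hμ j)).ne'
  have hzy : zᴴ * Jmat α * y = 0 := by
    have := congrArg Matrix.conjTranspose hyz
    simpa [Jmat_conjTranspose, ← Matrix.mul_assoc] using this
  refine ⟨fromCols y z, ?_, ?_, ?_⟩
  · rw [isDoubled_iff_conjSwap_eq]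
    ext i (j | j) <;> simp [conjSwap, swapCols, hz]
  · rw [conjTranspose_fromCols_eq_fromRows_conjTranspose, fromRows_mul, fromRows_mul_fromCols,
      hyy, hyz, hzy, hzz]
    rfl
  · rw [mul_fromCols, hyD, hzD, fromCols_mul_fromBlocks]
    simp

/-- The invertible `Jmat κ` factors through the space of doubled `α`-coordinates, which bounds its
rank. This controls the number of eigenvalues of either sign in Williamson's theorem. -/
theorem card_le_of_conjTranspose_mul_Jmat_mul {κ : Type*} [Fintype κ] [DecidableEq κ]
    {W : Matrix (α ⊕ α) (κ ⊕ κ) ℂ} (h : Wᴴ * Jmat α * W = Jmat κ) :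
    Fintype.card κ ≤ Fintype.card α := by
  have h1 : (Jmat κ).rank = Fintype.card (κ ⊕ κ) :=
    rank_of_isUnit _ (IsUnit.of_mul_eq_one _ Jmat_mul_Jmat)
  have h2 : (Jmat κ).rank ≤ Fintype.card (α ⊕ α) := by
    rw [← h, Matrix.mul_assoc]
    exact (rank_mul_le_right _ _).trans ((rank_mul_le_right _ _).trans (rank_le_card_height _))
  rw [h1, Fintype.card_sum, Fintype.card_sum] at h2
  omega

/-- **Williamson's theorem** in doubled-up coordinates. -/
theorem exists_isCanonicalBasis {P : Matrix (α ⊕ α) (α ⊕ α) ℂ} (hP : P.PosSemidef)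
    (hc : conjSwap P = P - Jmat α) : ∃ T ν, IsCanonicalBasis P T ν := by
  set σ := P + conjSwap P with hσdef
  have hσJ : σ = P + P - Jmat α := by rw [hσdef, hc]; abel
  have hσc : conjSwap σ = σ := by rw [hσdef, conjSwap_add, conjSwap_conjSwap, add_comm]
  have hσ0 : σ.PosSemidef := hP.add (conjSwap_posSemidef hP)
  -- If `σ x = 0`, both positive summands kill `x`; they differ by `J`, so `J x = 0`.
  have hσu : IsUnit σ := by
    rw [← mulVec_injective_iff_isUnit]
    refine (injective_iff_map_eq_zero σ.mulVecLin).2 fun x hx => ?_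
    rw [mulVecLin_apply] at hx
    have h1 : star x ⬝ᵥ P *ᵥ x + star x ⬝ᵥ conjSwap P *ᵥ x = 0 := by
      rw [← dotProduct_add, ← add_mulVec, ← hσdef, hx, dotProduct_zero]
    have h2 := (add_eq_zero_iff_of_nonneg (hP.dotProduct_mulVec_nonneg x)
      ((conjSwap_posSemidef hP).dotProduct_mulVec_nonneg x)).1 h1
    have h3 := (hP.dotProduct_mulVec_zero_iff x).1 h2.1
    have h4 := ((conjSwap_posSemidef hP).dotProduct_mulVec_zero_iff x).1 h2.2
    rw [hc, sub_mulVec, h3, zero_sub, neg_eq_zero] at h4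
    rw [← one_mulVec x, ← Jmat_mul_Jmat, ← mulVec_mulVec, h4, mulVec_zero]
  obtain ⟨B, hB⟩ : ∃ B : Matrix (α ⊕ α) (α ⊕ α) ℂ, σ = B * Bᴴ := by
    obtain ⟨B, hB⟩ := CStarAlgebra.nonneg_iff_eq_star_mul_self.mp hσ0.nonneg
    exact ⟨Bᴴ, by rw [hB, star_eq_conjTranspose, conjTranspose_conjTranspose]⟩
  have hBu : IsUnit B := by
    rw [Matrix.isUnit_iff_isUnit_det] at hσu ⊢
    rw [hB, det_mul] at hσu
    exact isUnit_of_mul_isUnit_left hσu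
  -- Since `σ J B = B H`, the images under `B` of an orthonormal eigenbasis of the Hermitian `H`
  -- diagonalize `σ J`; they are `J`-orthogonal, with `J`-norms equal to the eigenvalues.
  set H := Bᴴ * Jmat α * B with hHdef
  have hH : H.IsHermitian := by
    unfold Matrix.IsHermitian
    rw [hHdef]
    simp [Jmat_conjTranspose, Matrix.mul_assoc]
  have hHu : IsUnit H := ((hBu.star).mul (IsUnit.of_mul_eq_one _ Jmat_mul_Jmat)).mul hBu
  set U : Matrix (α ⊕ α) (α ⊕ α) ℂ := hH.eigenvectorUnitary.1 with hU
  set L : Matrix (α ⊕ α) (α ⊕ α) ℂ := diagonal fun i => (hH.eigenvalues i : ℂ) with hL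
  have hUU : Uᴴ * U = 1 := UnitaryGroup.star_mul_self _
  have hHL : H * U = U * L := by
    have h1 := hH.spectral_theorem
    rw [Unitary.conjStarAlgAut_apply] at h1
    conv_lhs => rw [h1]
    rw [Matrix.mul_assoc]
    erw [hUU]
    rw [Matrix.mul_one]
    rfl
  set w := B * U with hw
  have hw1 : σ * Jmat α * w = w * L := by
    rw [hw, Matrix.mul_assoc B, ← hHL, hB, hHdef]
    simp only [Matrix.mul_assoc]
  have hw2 : wᴴ * Jmat α * w = L := by
    calc wᴴ * Jmat α * w = Uᴴ * (H * U) := by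
          rw [hw, hHdef, conjTranspose_mul]; simp only [Matrix.mul_assoc]
      _ = L := by rw [hHL, ← Matrix.mul_assoc, hUU, Matrix.one_mul]
  have hne : ∀ i, hH.eigenvalues i ≠ 0 := by
    intro i h0
    have h1 := hH.det_eq_prod_eigenvalues
    rw [Finset.prod_eq_zero (Finset.mem_univ i) (by simp [h0])] at h1
    exact ((Matrix.isUnit_iff_isUnit_det _).1 hHu).ne_zero h1
  have hpos (κ : Type _) [Fintype κ] [DecidableEq κ] (f : κ → α ⊕ α)
      (hf : Function.Injective f) (hfp : ∀ i, 0 < hH.eigenvalues (f i)) :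
      ∃ W : Matrix (α ⊕ α) (κ ⊕ κ) ℂ, IsDoubled W ∧ Wᴴ * Jmat α * W = Jmat κ ∧
      σ * Jmat α * W = W * fromBlocks (diagonal fun i => (hH.eigenvalues (f i) : ℂ)) 0 0
        (-diagonal fun i => (hH.eigenvalues (f i) : ℂ)) := by
    refine exists_doubled_frame hσ0.isHermitian hσc (w.submatrix id f) _ hfp ?_ ?_
    · ext i j
      have := congrFun (congrFun hw1 i) (f j)
      rw [hL, mul_diagonal] at this
      rw [mul_diagonal]
      exact this
    · ext i j
      have := congrFun (congrFun hw2 (f i)) (f j)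
      rw [hL, diagonal_apply] at this
      simp only [diagonal_apply, ← hf.eq_iff]
      exact this
  -- Conjugated eigenvectors for negative eigenvalues have positive ones, so they span a frame as
  -- well.
  have hneg (κ : Type _) [Fintype κ] [DecidableEq κ] (f : κ → α ⊕ α)
      (hf : Function.Injective f) (hfn : ∀ i, hH.eigenvalues (f i) < 0) :
      ∃ W : Matrix (α ⊕ α) (κ ⊕ κ) ℂ, Wᴴ * Jmat α * W = Jmat κ := by
    refine (exists_doubled_frame hσ0.isHermitian hσc
      ((swapCols w).submatrix id f) (fun i => -hH.eigenvalues (f i))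
      (fun i => neg_pos.2 (hfn i)) ?_ ?_).imp fun W hW => hW.2.1
    · have h1 := conjSwap_mul_swapCols (σ * Jmat α) w
      rw [conjSwap_mul, hσc, conjSwap_Jmat, Matrix.mul_neg, Matrix.neg_mul, hw1,
        neg_eq_iff_eq_neg] at h1
      ext i j
      have := congrFun (congrFun h1 i) (f j)
      rw [mul_diagonal]
      refine this.trans ?_
      simp [swapCols, hL, mul_diagonal]
    · have h1 := conjSwap_mul_swapCols (Jmat α) w
      rw [conjSwap_Jmat, Matrix.neg_mul, neg_eq_iff_eq_neg] at h1
      have h2 : (swapCols w)ᴴ * Jmat α * swapCols w = -L := by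
        rw [Matrix.mul_assoc, h1, Matrix.mul_neg, swapCols_conjTranspose_mul, ← Matrix.mul_assoc,
          hw2]
        ext i j
        by_cases hij : i = j <;> simp [hL, hij]
      ext i j
      have := congrFun (congrFun h2 (f i)) (f j)
      rw [Matrix.neg_apply, hL, diagonal_apply] at this
      simp only [diagonal_apply, ← hf.eq_iff]
      refine this.trans ?_
      split_ifs <;> simp
  -- The eigenvalues number `2 |α|`, none is zero, and each sign occurs at most `|α|` times, so each
  -- occurs exactly `|α|` times.
  have hcard : Fintype.card {i // 0 < hH.eigenvalues i} = Fintype.card α := by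
    obtain ⟨W₁, -, h₁, -⟩ := hpos {i // 0 < hH.eigenvalues i} Subtype.val
      Subtype.val_injective fun i => i.2
    obtain ⟨W₂, h₂⟩ := hneg {i // ¬ 0 < hH.eigenvalues i} Subtype.val
      Subtype.val_injective fun i => lt_of_le_of_ne (not_lt.1 i.2) (hne i)
    have h₃ := card_le_of_conjTranspose_mul_Jmat_mul h₁
    have h₄ := card_le_of_conjTranspose_mul_Jmat_mul h₂
    have h₅ := Fintype.card_congr (Equiv.sumCompl fun i => 0 < hH.eigenvalues i)
    rw [Fintype.card_sum, Fintype.card_sum] at h₅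
    omega
  let e := (Fintype.equivOfCardEq hcard).symm
  obtain ⟨W, hWd, hWJ, hWσ⟩ := hpos α (fun i => (e i).1)
    (Subtype.val_injective.comp e.injective) fun i => (e i).2
  set D : Matrix α α ℂ := diagonal fun i => (hH.eigenvalues (e i).1 : ℂ) with hD
  have hsymp : IsSymplectic W := by
    have h1 : flat W * W = 1 := by
      rw [flat, Matrix.mul_assoc, Matrix.mul_assoc, ← Matrix.mul_assoc Wᴴ, hWJ, Jmat_mul_Jmat]
    exact ⟨hWd, h1, mul_eq_one_comm.1 h1⟩
  have hσT : flat W * σ * (flat W)ᴴ = fromBlocks D 0 0 D := by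
    calc flat W * σ * (flat W)ᴴ
        = Jmat α * (Wᴴ * Jmat α * (σ * Jmat α * W)) * Jmat α := by
          rw [flat_conjTranspose, flat]; simp only [Matrix.mul_assoc]
      _ = Jmat α * (Wᴴ * Jmat α * W) * fromBlocks D 0 0 (-D) * Jmat α := by
          rw [hWσ]; simp only [Matrix.mul_assoc]
      _ = fromBlocks D 0 0 D := by
          rw [hWJ, Jmat_mul_Jmat, Matrix.one_mul, Jmat, fromBlocks_multiply]; simp
  -- From `2 P = σ + J`, the photon numbers are `(μ - 1) / 2`.
  have hcov : flat W * P * (flat W)ᴴ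
      = thermalCov fun i => (hH.eigenvalues (e i).1 - 1) / 2 := by
    have h1 : (2 : ℂ) • P = σ + Jmat α := by rw [hσJ, two_smul]; abel
    have h2 : (2 : ℂ) • (flat W * P * (flat W)ᴴ) = fromBlocks D 0 0 D + Jmat α := by
      rw [← hσT, ← hsymp.flat.mul_Jmat_mul_conjTranspose, ← Matrix.add_mul, ← Matrix.mul_add,
        ← h1, Matrix.mul_smul, Matrix.smul_mul]
    have h3 : flat W * P * (flat W)ᴴ = (1 / 2 : ℂ) • (fromBlocks D 0 0 D + Jmat α) := by
      rw [← h2, smul_smul]; norm_num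
    rw [h3, thermalCov, Jmat, fromBlocks_add, fromBlocks_smul, hD]
    congr 1
    · rw [← diagonal_one, diagonal_add, ← diagonal_smul]
      congr 1
      ext i
      simp
      ring
    · simp
    · simp
    · rw [← diagonal_one, diagonal_neg, diagonal_add, ← diagonal_smul]
      congr 1
      ext i
      simp
      ring
  refine ⟨flat W, _, hsymp.flat, fun i => ?_, hcov⟩
  -- The creation half of the diagonal of a positive semidefinite matrix is exactly `ν`.
  have h1 := (hP.mul_mul_conjTranspose_same (flat W)).diag_nonneg (i := Sum.inr i)
  rw [hcov, thermalCov, fromBlocks_apply₂₂, diagonal_apply_eq] at h1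
  exact_mod_cast h1

end Williamson

end QuantumLinear

namespace QuantumLinear

/-! ### Rational functions, Markov parameters and minimal realizations. -/

section Realizations

open Filter Topology Bornology

variable {a b c d p q : Type*} [Fintype a] [DecidableEq a] [Fintype b] [DecidableEq b]
  [Fintype c] [DecidableEq c] [Fintype d] [DecidableEq d]

theorem eventually_isUnit_sub (A : Matrix a a ℂ) :
    ∀ᶠ s in cobounded ℂ, IsUnit (s • (1 : Matrix a a ℂ) - A) := by
  have h : IsBounded (spectrum ℂ A) := (Matrix.finite_spectrum A).isBounded
  filter_upwards [isBounded_def.1 h] with s hs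
  rwa [Set.mem_compl_iff, spectrum.mem_iff, not_not, Algebra.algebraMap_eq_smul_one] at hs

theorem tendsto_mul_resolvent_mul (A : Matrix a a ℂ) (X : Matrix p a ℂ) (Y : Matrix a q ℂ) :
    Tendsto (fun s : ℂ => X * (s • (1 : Matrix a a ℂ) - A)⁻¹ * Y) (cobounded ℂ) (𝓝 0) := by
  have hc : Continuous fun Z : Matrix a a ℂ => X * Z * Y := by fun_prop
  have h := (hc.tendsto 0).comp (tendsto_resolvent A)
  simpa [Function.comp_def] using h

theorem mul_mul_resolvent {A : Matrix a a ℂ} {s : ℂ} (h : IsUnit (s • (1 : Matrix a a ℂ) - A))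
    (X : Matrix p a ℂ) (Y : Matrix a q ℂ) :
    X * A * (s • (1 : Matrix a a ℂ) - A)⁻¹ * Y
      = s • (X * (s • (1 : Matrix a a ℂ) - A)⁻¹ * Y) - X * Y := by
  have h1 : A * (s • (1 : Matrix a a ℂ) - A)⁻¹ = s • (s • (1 : Matrix a a ℂ) - A)⁻¹ - 1 := by
    have h2 := mul_nonsing_inv _ ((Matrix.isUnit_iff_isUnit_det _).1 h)
    rw [Matrix.sub_mul, Matrix.smul_mul, Matrix.one_mul] at h2
    exact eq_sub_of_add_eq ((add_comm _ _).trans (sub_eq_iff_eq_add.1 h2).symm)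
  rw [Matrix.mul_assoc X, h1]
  simp [Matrix.mul_sub, Matrix.sub_mul]

section fourTerms

variable {A : Matrix a a ℂ} {B : Matrix b b ℂ} {A' : Matrix c c ℂ} {B' : Matrix d d ℂ}
  {Y : Matrix a q ℂ} {M : Matrix b q ℂ} {Y' : Matrix c q ℂ} {M' : Matrix d q ℂ}

theorem const_eq_zero_of_eventually_eq {X : Matrix p a ℂ} {L : Matrix p b ℂ} {X' : Matrix p c ℂ}
    {L' : Matrix p d ℂ} {D : Matrix p q ℂ}
    (h : ∀ᶠ s : ℂ in cobounded ℂ,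
      X * (s • (1 : Matrix a a ℂ) - A)⁻¹ * Y + L * (s • (1 : Matrix b b ℂ) - B)⁻¹ * M
      - (X' * (s • (1 : Matrix c c ℂ) - A')⁻¹ * Y' + L' * (s • (1 : Matrix d d ℂ) - B')⁻¹ * M')
      = D) : D = 0 := by
  have h1 := ((tendsto_mul_resolvent_mul A X Y).add (tendsto_mul_resolvent_mul B L M)).sub
    ((tendsto_mul_resolvent_mul A' X' Y').add (tendsto_mul_resolvent_mul B' L' M'))
  have h2 := h1.congr' h
  have h3 := tendsto_nhds_unique tendsto_const_nhds h2
  simpa using h3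

/-- Multiplication by `s` replaces `X` by `X A` up to a constant. The limit at infinity evaluates
this constant, so iteration reads off the Markov parameters one by one. -/
theorem eventually_eq_shift {X : Matrix p a ℂ} {L : Matrix p b ℂ} {X' : Matrix p c ℂ}
    {L' : Matrix p d ℂ}
    (h : ∀ᶠ s : ℂ in cobounded ℂ,
      X * (s • (1 : Matrix a a ℂ) - A)⁻¹ * Y + L * (s • (1 : Matrix b b ℂ) - B)⁻¹ * M
      - (X' * (s • (1 : Matrix c c ℂ) - A')⁻¹ * Y' + L' * (s • (1 : Matrix d d ℂ) - B')⁻¹ * M')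
      = 0) :
    ∀ᶠ s : ℂ in cobounded ℂ,
      X * A * (s • (1 : Matrix a a ℂ) - A)⁻¹ * Y + L * B * (s • (1 : Matrix b b ℂ) - B)⁻¹ * M
      - (X' * A' * (s • (1 : Matrix c c ℂ) - A')⁻¹ * Y'
        + L' * B' * (s • (1 : Matrix d d ℂ) - B')⁻¹ * M')
      = X' * Y' + L' * M' - (X * Y + L * M) := by
  filter_upwards [h, eventually_isUnit_sub A, eventually_isUnit_sub B,
    eventually_isUnit_sub A', eventually_isUnit_sub B'] with s hs h1 h2 h3 h4
  rw [mul_mul_resolvent h1, mul_mul_resolvent h2, mul_mul_resolvent h3, mul_mul_resolvent h4]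
  have h5 := congrArg (s • ·) hs
  simp only [smul_sub, smul_add, smul_zero] at h5
  rw [← sub_eq_zero, ← h5]
  abel

/-- Equality of rational functions at infinity gives equality of all Markov parameters. -/
theorem markov_eq_of_eventually_eq {X : Matrix p a ℂ} {L : Matrix p b ℂ} {X' : Matrix p c ℂ}
    {L' : Matrix p d ℂ} {D : Matrix p q ℂ}
    (h : ∀ᶠ s : ℂ in cobounded ℂ,
      X * (s • (1 : Matrix a a ℂ) - A)⁻¹ * Y + L * (s • (1 : Matrix b b ℂ) - B)⁻¹ * M
      - (X' * (s • (1 : Matrix c c ℂ) - A')⁻¹ * Y' + L' * (s • (1 : Matrix d d ℂ) - B')⁻¹ * M')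
      = D) (j : ℕ) :
    X * A ^ j * Y + L * B ^ j * M = X' * A' ^ j * Y' + L' * B' ^ j * M' := by
  have hD := const_eq_zero_of_eventually_eq h
  subst hD
  have h1 := eventually_eq_shift h
  induction j generalizing X L X' L' with
  | zero => simpa using (sub_eq_zero.1 (const_eq_zero_of_eventually_eq h1)).symm
  | succ j ih =>
    rw [const_eq_zero_of_eventually_eq h1] at h1
    simpa [pow_succ', Matrix.mul_assoc] using ih h1 (eventually_eq_shift h1)

theorem mul_aeval_mul_eq {X : Matrix p a ℂ} {L : Matrix p b ℂ} {X' : Matrix p c ℂ}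
    {L' : Matrix p d ℂ}
    (h : ∀ j : ℕ, X * A ^ j * Y + L * B ^ j * M = X' * A' ^ j * Y' + L' * B' ^ j * M')
    (f : Polynomial ℂ) :
    X * Polynomial.aeval A f * Y + L * Polynomial.aeval B f * M
      = X' * Polynomial.aeval A' f * Y' + L' * Polynomial.aeval B' f * M' := by
  induction f using Polynomial.induction_on' with
  | add f g hf hg =>
    simp only [map_add, Matrix.mul_add, Matrix.add_mul]
    rw [add_add_add_comm, hf, hg, add_add_add_comm]
  | monomial k r =>
    have h1 := congrArg (r • ·) (h k)
    simp only [smul_add] at h1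
    simpa [Polynomial.aeval_monomial, Algebra.algebraMap_eq_smul_one] using h1

/-- The Markov parameters of the stable part of a rational function are determined by the
function. -/
theorem stable_markov_eq_of_eventually_eq (hA : IsStable A) (hA' : IsStable A')
    (hB : IsStable (-B)) (hB' : IsStable (-B'))
    {X : Matrix p a ℂ} {L : Matrix p b ℂ} {X' : Matrix p c ℂ}
    {L' : Matrix p d ℂ} {D : Matrix p q ℂ}
    (h : ∀ᶠ s : ℂ in cobounded ℂ,
      X * (s • (1 : Matrix a a ℂ) - A)⁻¹ * Y + L * (s • (1 : Matrix b b ℂ) - B)⁻¹ * M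
      - (X' * (s • (1 : Matrix c c ℂ) - A')⁻¹ * Y' + L' * (s • (1 : Matrix d d ℂ) - B')⁻¹ * M')
      = D) (j : ℕ) :
    X * A ^ j * Y = X' * A' ^ j * Y' := by
  obtain ⟨f, h1, h2, h3, h4⟩ := exists_polynomial_aeval_eq_one_aeval_eq_zero hA hA'
    (B := B) (B' := B') (fun z hz => by simpa using hB (-z) (mem_spectrum_neg.2 (by simpa)))
    (fun z hz => by simpa using hB' (-z) (mem_spectrum_neg.2 (by simpa)))
  -- The factor `f` is `1` on the stable matrices and `0` on the antistable ones, so it filters out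
  -- the second terms.
  have h5 := mul_aeval_mul_eq (markov_eq_of_eventually_eq h) (f * Polynomial.X ^ j)
  simpa [h1, h2, h3, h4] using h5

end fourTerms

theorem exists_eigenvector_mem {V : Type*} [AddCommGroup V] [Module ℂ V] [FiniteDimensional ℂ V]
    (f : V →ₗ[ℂ] V) {W : Submodule ℂ V} (hW : W ≠ ⊥) (hf : ∀ x ∈ W, f x ∈ W) :
    ∃ z : ℂ, ∃ x ∈ W, x ≠ 0 ∧ f x = z • x := by
  have : Nontrivial W := Submodule.nontrivial_iff_ne_bot.2 hW
  obtain ⟨z, hz⟩ := Module.End.exists_eigenvalue (f.restrict hf)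
  obtain ⟨x, hx⟩ := hz.exists_hasEigenvector
  refine ⟨z, x, x.2, fun h => hx.2 (Subtype.ext h), ?_⟩
  exact congrArg Subtype.val hx.apply_eq_smul

/-- The observability map `x ↦ (C Aʲ x)ⱼ`. -/
noncomputable def observabilityMap (A : Matrix a a ℂ) (C : Matrix p a ℂ) :
    (a → ℂ) →ₗ[ℂ] (ℕ → p → ℂ) :=
  LinearMap.pi fun j => (C * A ^ j).mulVecLin

theorem observabilityMap_apply (A : Matrix a a ℂ) (C : Matrix p a ℂ) (x : a → ℂ) (j : ℕ) :
    observabilityMap A C x j = (C * A ^ j) *ᵥ x := rfl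

/-- The kernel is invariant under `A`, so if it were nonzero it would contain an eigenvector of `A`
killed by `C`. -/
theorem observabilityMap_ker_eq_bot {A : Matrix a a ℂ} {C : Matrix p a ℂ}
    (h : ∀ (z : ℂ) (x : a → ℂ), A *ᵥ x = z • x → C *ᵥ x = 0 → x = 0) :
    LinearMap.ker (observabilityMap A C) = ⊥ := by
  by_contra hne
  obtain ⟨z, x, hx, hx0, hxz⟩ := exists_eigenvector_mem A.mulVecLin hne fun x hx => by
    rw [LinearMap.mem_ker] at hx ⊢
    ext1 j
    have := congrFun hx (j + 1)
    rw [observabilityMap_apply] at this ⊢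
    rw [mulVecLin_apply, mulVec_mulVec, Matrix.mul_assoc, ← pow_succ, this]
    rfl
  refine hx0 (h z x hxz ?_)
  have := congrFun (LinearMap.mem_ker.1 hx) 0
  simpa [observabilityMap_apply] using this

/-- Dual to observability: a functional vanishing on all reachable vectors is given by a vector in
the unobservable space of `(Aᴴ, Kᴴ)`. -/
theorem iSup_range_eq_top [Fintype q] {A : Matrix a a ℂ} {K : Matrix a q ℂ}
    (h : ∀ (z : ℂ) (y : a → ℂ), Aᴴ *ᵥ y = z • y → Kᴴ *ᵥ y = 0 → y = 0) :
    ⨆ j, LinearMap.range (A ^ j * K).mulVecLin = ⊤ := by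
  by_contra hne
  obtain ⟨f, hf0, hf⟩ := Submodule.exists_le_ker_of_lt_top _ (lt_top_iff_ne_top.2 hne)
  set y : a → ℂ := fun i => star (f (Pi.single i 1)) with hy
  have hfy : ∀ x, f x = star y ⬝ᵥ x := by
    intro x
    conv_lhs => rw [pi_eq_sum_univ' x, map_sum]
    simp only [map_smul, smul_eq_mul, dotProduct, hy, Pi.star_apply, star_star]
    exact Finset.sum_congr rfl fun i _ => mul_comm _ _
  have hy0 : observabilityMap Aᴴ Kᴴ y = 0 := by
    ext1 j
    rw [observabilityMap_apply, ← conjTranspose_pow, ← conjTranspose_mul]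
    have h1 : ∀ v, star y ⬝ᵥ ((A ^ j * K) *ᵥ v) = 0 := by
      intro v
      rw [← hfy]
      exact hf (Submodule.mem_iSup_of_mem j ⟨v, rfl⟩)
    have h2 : star y ᵥ* (A ^ j * K) = 0 := by
      refine dotProduct_eq_zero_iff.1 fun v => ?_
      rw [← dotProduct_mulVec, h1]
    have h3 := congrArg star h2
    rwa [star_vecMul, star_star, star_zero] at h3
  have hy1 : y = 0 := by
    have := LinearMap.mem_ker.2 hy0
    rwa [observabilityMap_ker_eq_bot h] at this
  refine hf0 (LinearMap.ext fun x => ?_)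
  rw [hfy, hy1]
  simp

/-- A realization that passes the observability and controllability eigenvector tests has the
least number of states among those with the same Markov parameters. -/
theorem card_le_of_markov_eq [Fintype q] {A : Matrix a a ℂ} {C : Matrix p a ℂ} {K : Matrix a q ℂ}
    {A' : Matrix b b ℂ} {C' : Matrix p b ℂ} {K' : Matrix b q ℂ}
    (hobs : ∀ (z : ℂ) (x : a → ℂ), A *ᵥ x = z • x → C *ᵥ x = 0 → x = 0)
    (hctr : ∀ (z : ℂ) (y : a → ℂ), Aᴴ *ᵥ y = z • y → Kᴴ *ᵥ y = 0 → y = 0)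
    (h : ∀ j : ℕ, C * A ^ j * K = C' * A' ^ j * K') : Fintype.card a ≤ Fintype.card b := by
  -- The vectors `Aʲ K v` span the state space, and their images `(C Aⁱ⁺ʲ K v)ᵢ` involve only Markov
  -- parameters, so the other realization produces them too.
  have h1 : LinearMap.range (observabilityMap A C) ≤ LinearMap.range (observabilityMap A' C') := by
    rw [LinearMap.range_eq_map, ← iSup_range_eq_top hctr, Submodule.map_iSup]
    refine iSup_le fun j => ?_
    rintro _ ⟨_, ⟨v, rfl⟩, rfl⟩
    refine ⟨(A' ^ j * K') *ᵥ v, ?_⟩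
    ext1 i
    have h2 := h (i + j)
    rw [observabilityMap_apply, observabilityMap_apply, mulVecLin_apply, mulVec_mulVec,
      mulVec_mulVec, ← Matrix.mul_assoc, ← Matrix.mul_assoc, Matrix.mul_assoc C,
      Matrix.mul_assoc C', ← pow_add, ← pow_add, h2]
  have h2 := Submodule.finrank_mono h1
  rw [LinearMap.finrank_range_of_inj (LinearMap.ker_eq_bot.1 (observabilityMap_ker_eq_bot hobs)),
    Module.finrank_fintype_fun_eq_card] at h2
  refine h2.trans ((LinearMap.finrank_range_le _).trans ?_)
  rw [Module.finrank_fintype_fun_eq_card]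

end Realizations

end QuantumLinear

namespace QuantumLinear

open scoped ComplexOrder

/-! ### Vacuum covariance and rules for `♭`. -/

section Vacuum

variable {α : Type*} [DecidableEq α]

/-- The covariance matrix `diag (1, 0)` of the vacuum. -/
abbrev vacuumCov (α : Type*) [DecidableEq α] : Matrix (α ⊕ α) (α ⊕ α) ℂ := thermalCov (0 : α → ℝ)

theorem vacuumCov_eq : vacuumCov α = fromBlocks 1 0 0 0 := by
  simp [thermalCov]

theorem vacuumCov_conjTranspose : (vacuumCov α)ᴴ = vacuumCov α := by
  rw [vacuumCov_eq, fromBlocks_conjTranspose]; simp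

theorem conjSwap_vacuumCov : conjSwap (vacuumCov α) = vacuumCov α - Jmat α := by
  rw [vacuumCov_eq]
  ext (i | i) (j | j)
  · simp [conjSwap, Jmat]
  · simp [conjSwap, Jmat]
  · simp [conjSwap, Jmat]
  · by_cases h : i = j <;> simp [conjSwap, Jmat, h]

variable [Fintype α]

theorem vacuumCov_mul_Jmat : vacuumCov α * Jmat α = vacuumCov α := by
  rw [vacuumCov_eq, Jmat, fromBlocks_multiply]; simp

theorem vacuumCov_mul_self : vacuumCov α * vacuumCov α = vacuumCov α := by
  rw [vacuumCov_eq, fromBlocks_multiply]; simp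

theorem vacuumCov_posSemidef : (vacuumCov α).PosSemidef := by
  have h := posSemidef_self_mul_conjTranspose (vacuumCov α)
  rwa [vacuumCov_conjTranspose, vacuumCov_mul_self] at h

variable {R V : Matrix (α ⊕ α) (α ⊕ α) ℂ}

theorem IsSymplectic.eq_flat_mul_mul (hR : IsSymplectic R) {W : Matrix (α ⊕ α) (α ⊕ α) ℂ}
    (h : R * V * Rᴴ = W) : V = QuantumLinear.flat R * W * (QuantumLinear.flat R)ᴴ := by
  have h1 : Rᴴ * (QuantumLinear.flat R)ᴴ = 1 := by
    rw [← conjTranspose_mul, hR.flat_mul, conjTranspose_one]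
  rw [← h]
  calc V = (QuantumLinear.flat R * R) * V * (Rᴴ * (QuantumLinear.flat R)ᴴ) := by
        rw [h1, hR.flat_mul, Matrix.one_mul, Matrix.mul_one]
    _ = _ := by simp only [Matrix.mul_assoc]

theorem IsSymplectic.posSemidef_of_vacuumCov (hR : IsSymplectic R)
    (h : R * V * Rᴴ = vacuumCov α) : V.PosSemidef := by
  rw [hR.eq_flat_mul_mul h]
  exact vacuumCov_posSemidef.mul_mul_conjTranspose_same _

/-- The relation encodes the canonical commutation relations, and conjugation by a symplectic matrix
fixes `J`. -/
theorem IsSymplectic.conjSwap_of_conj (hR : IsSymplectic R) {W : Matrix (α ⊕ α) (α ⊕ α) ℂ}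
    (hW : conjSwap W = W - Jmat α) (h : R * V * Rᴴ = W) : conjSwap V = V - Jmat α := by
  have h1 := hR.flat.mul_Jmat_mul_conjTranspose
  conv_rhs => rw [hR.eq_flat_mul_mul h, ← h1]
  rw [hR.eq_flat_mul_mul h, conjSwap_mul, conjSwap_mul, conjSwap_conjTranspose,
    hR.flat.conjSwap_eq, hW, Matrix.mul_sub, Matrix.sub_mul]

end Vacuum

section FlatAlgebra

variable {α β : Type*} [Fintype α] [DecidableEq α] [Fintype β] [DecidableEq β]

theorem flat_sub (X Y : Matrix (α ⊕ α) (β ⊕ β) ℂ) : flat (X - Y) = flat X - flat Y := by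
  simp [flat, Matrix.mul_sub, Matrix.sub_mul]

theorem flat_neg (X : Matrix (α ⊕ α) (β ⊕ β) ℂ) : flat (-X) = -flat X := by
  simp [flat]

theorem flat_smul (c : ℂ) (X : Matrix (α ⊕ α) (β ⊕ β) ℂ) : flat (c • X) = star c • flat X := by
  simp [flat, conjTranspose_smul]

theorem flat_Jmat_mul {Ω : Matrix (α ⊕ α) (α ⊕ α) ℂ} (h : Ω.IsHermitian) :
    flat (Jmat α * Ω) = Jmat α * Ω := by
  rw [flat, conjTranspose_mul, Jmat_conjTranspose, h.eq, Matrix.mul_assoc, Matrix.mul_assoc,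
    Jmat_mul_Jmat, Matrix.mul_one]

theorem Jmat_mul_conjTranspose (X : Matrix (α ⊕ α) (β ⊕ β) ℂ) :
    Jmat β * Xᴴ = flat X * Jmat α := by
  rw [flat, mul_Jmat_cancel]

theorem conjTranspose_mul_Jmat (X : Matrix (α ⊕ α) (β ⊕ β) ℂ) :
    Xᴴ * Jmat α = Jmat β * flat X := by
  rw [flat, Matrix.mul_assoc, Jmat_mul_cancel]

end FlatAlgebra

/-! ### Observability and controllability of quantum linear systems. -/

section EigenvectorTests

variable {α κ : Type*} [Fintype α] [DecidableEq α] [Fintype κ] [DecidableEq κ]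
  {A : Matrix (α ⊕ α) (α ⊕ α) ℂ} {C : Matrix (κ ⊕ κ) (α ⊕ α) ℂ}

/-- A stable quantum linear system is observable. -/
theorem eq_zero_of_eigenvector_of_mulVec_eq_zero (hA : IsStable A)
    (hAC : A + flat A + flat C * C = 0) {z : ℂ} {x : α ⊕ α → ℂ} (hx : A *ᵥ x = z • x)
    (hC : C *ᵥ x = 0) : x = 0 := by
  by_contra hx0
  have hz := hA z (mem_spectrum_iff_exists_eigenvector.2 ⟨x, hx0, hx⟩)
  have h1 : flat A *ᵥ x = -z • x := by
    have h2 := congrArg (· *ᵥ x) hAC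
    simp only [add_mulVec, ← mulVec_mulVec, hC, mulVec_zero, zero_mulVec, add_zero, hx] at h2
    rw [neg_smul]
    exact (neg_eq_of_add_eq_zero_right h2).symm
  -- `A†` and `A^♭` are conjugate through `J`, so the stable `A†` would have the eigenvalue `-z`
  -- with positive real part.
  have h2 : Aᴴ *ᵥ (Jmat α *ᵥ x) = -z • Jmat α *ᵥ x := by
    rw [mulVec_mulVec, conjTranspose_mul_Jmat, ← mulVec_mulVec, h1, mulVec_smul]
  have h3 : Jmat α *ᵥ x ≠ 0 := by
    intro h0
    apply hx0
    rw [← one_mulVec x, ← Jmat_mul_Jmat, ← mulVec_mulVec, h0, mulVec_zero]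
  have h4 := hA.conjTranspose (-z) (mem_spectrum_iff_exists_eigenvector.2 ⟨_, h3, h2⟩)
  rw [Complex.neg_re] at h4
  linarith

/-- A stable quantum linear system with vacuum input and invertible stationary covariance is
controllable from the input of the stable part of its power spectrum. -/
theorem eq_zero_of_eigenvector_of_invertible_cov (hA : IsStable A)
    (hAC : A + flat A + flat C * C = 0) {P : Matrix (α ⊕ α) (α ⊕ α) ℂ}
    (hL : A * P + P * Aᴴ + flat C * vacuumCov κ * (flat C)ᴴ = 0)
    (hc : conjSwap P = P - Jmat α) (hu : IsUnit P) {z : ℂ} {y : α ⊕ α → ℂ}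
    (hy : Aᴴ *ᵥ y = z • y) (hK : C *ᵥ P *ᵥ y = vacuumCov κ *ᵥ C *ᵥ Jmat α *ᵥ y) : y = 0 := by
  by_contra hy0
  have hz := hA.conjTranspose z (mem_spectrum_iff_exists_eigenvector.2 ⟨y, hy0, hy⟩)
  have hJJ : ∀ v : α ⊕ α → ℂ, Jmat α *ᵥ Jmat α *ᵥ v = v := fun v => by
    rw [mulVec_mulVec, Jmat_mul_Jmat, one_mulVec]
  -- `hK` says `K† y = 0`; it puts `C P y` into the range of the vacuum projection.
  have hVC : vacuumCov κ *ᵥ C *ᵥ P *ᵥ y = C *ᵥ P *ᵥ y := by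
    rw [hK, mulVec_mulVec, vacuumCov_mul_self]
  have hQ : ∀ v, flat C *ᵥ vacuumCov κ *ᵥ C *ᵥ Jmat α *ᵥ v
      = -(A *ᵥ P *ᵥ v) - P *ᵥ Aᴴ *ᵥ v := by
    intro v
    have h1 := congrArg (· *ᵥ v) hL
    simp only [add_mulVec, ← mulVec_mulVec, zero_mulVec, flat_conjTranspose] at h1
    rw [mulVec_mulVec _ (vacuumCov κ) (Jmat κ), vacuumCov_mul_Jmat] at h1
    rw [← sub_eq_zero, ← h1]
    abel
  have h1 : A *ᵥ P *ᵥ y = -(z • P *ᵥ y) - flat C *ᵥ C *ᵥ P *ᵥ y := by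
    have := hQ y
    rw [← hK, hy, mulVec_smul] at this
    rw [this]; abel
  -- The Lyapunov equation at `y` combines with `A + A^♭ + C^♭ C = 0` to give `A^♭ P y = z P y`.
  have h2 : Aᴴ *ᵥ (Jmat α *ᵥ P *ᵥ y) = z • (Jmat α *ᵥ P *ᵥ y) := by
    have h3 := congrArg (· *ᵥ (P *ᵥ y)) hAC
    simp only [add_mulVec, zero_mulVec] at h3
    rw [h1, ← mulVec_mulVec] at h3
    have h4 : flat A *ᵥ P *ᵥ y = z • P *ᵥ y := by
      rw [← sub_eq_zero, ← h3]; abel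
    rw [mulVec_mulVec _ Aᴴ, conjTranspose_mul_Jmat, ← mulVec_mulVec, h4, mulVec_smul]
  -- At `J P y` the Lyapunov equation has the same noise term `C^♭ C P y` as at `y`. Subtraction
  -- leaves an eigenvector equation of `A` for `-z`, outside the spectrum.
  have h5 : A *ᵥ (P *ᵥ Jmat α *ᵥ P *ᵥ y - P *ᵥ y)
      = (-z) • (P *ᵥ Jmat α *ᵥ P *ᵥ y - P *ᵥ y) := by
    have h6 := hQ (Jmat α *ᵥ P *ᵥ y)
    rw [hJJ, hVC, h2, mulVec_smul] at h6
    rw [mulVec_sub, h1, h6, smul_sub, neg_smul, neg_smul]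
    abel
  have h6 : P *ᵥ Jmat α *ᵥ P *ᵥ y - P *ᵥ y = 0 := by
    by_contra h0
    have := hA _ (mem_spectrum_iff_exists_eigenvector.2 ⟨_, h0, h5⟩)
    rw [Complex.neg_re] at this
    linarith
  rw [← mulVec_sub] at h6
  -- Cancelling `P` leaves `J P y = y`, that is `(P - J) y = 0`, and `P - J = conjSwap P` is
  -- invertible along with `P`.
  have h7 := sub_eq_zero.1 (mulVec_injective_iff_isUnit.2 hu (h6.trans (mulVec_zero P).symm))
  have h8 : conjSwap P *ᵥ y = 0 := by
    rw [hc, sub_mulVec, sub_eq_zero]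
    conv_rhs => rw [← h7]
    rw [hJJ]
  have h9 : IsUnit (conjSwap P) := by
    obtain ⟨Q, hQ⟩ := hu.exists_right_inv
    refine IsUnit.of_mul_eq_one (conjSwap Q) ?_
    rw [← conjSwap_mul, hQ, isDoubled_iff_conjSwap_eq.1 IsDoubled.one]
  exact hy0 (mulVec_injective_iff_isUnit.2 h9 (h8.trans (mulVec_zero _).symm))

end EigenvectorTests

end QuantumLinear

/-! ### The stationary state, the split power spectrum, and minimality for invertible covariance. -/

namespace QLS

open scoped ComplexOrder

variable {ι κ : Type*} [Fintype ι] [DecidableEq ι] [Fintype κ] [DecidableEq κ] (G : QLS ι κ)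

/-- The Hamiltonian part `-i J Ω` of `A` is anti-self-adjoint for `♭` and cancels. -/
theorem A_add_flat_A : G.A + flat G.A + flat G.C * G.C = 0 := by
  have h : flat G.A = -((1 / 2 : ℂ) • (flat G.C * G.C)) + Complex.I • (Jmat ι * G.Ω) := by
    rw [A, flat_sub, flat_neg, flat_smul, flat_smul, flat_Jmat_mul G.hermitian_Ω,
      QuantumLinear.flat_mul, flat_flat]
    simp
  rw [h, A]
  have : flat G.C * G.C = (1 / 2 : ℂ) • (flat G.C * G.C) + (1 / 2 : ℂ) • (flat G.C * G.C) := by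
    rw [← add_smul]; norm_num
  nth_rewrite 3 [this]
  abel

/-- Preservation of the commutation relations in Lyapunov form: `J` solves the equation with input
`J`. -/
theorem A_mul_Jmat : G.A * Jmat ι + Jmat ι * G.Aᴴ + flat G.C * Jmat κ * (flat G.C)ᴴ = 0 := by
  have h := congrArg (· * Jmat ι) G.A_add_flat_A
  simp only [Matrix.add_mul, Matrix.zero_mul] at h
  rw [Jmat_mul_conjTranspose, flat_conjTranspose, ← h]
  congr 1
  simp only [Matrix.mul_assoc]
  rw [Jmat_mul_cancel]

theorem conjSwap_A : conjSwap G.A = G.A := by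
  rw [← isDoubled_iff_conjSwap_eq, A]
  have h1 := (G.doubled_C.flat.mul G.doubled_C)
  have h2 := G.doubled_Ω.smul_Jmat_mul 1
  have h3 : IsDoubled (-((1 / 2 : ℂ) • (flat G.C * G.C))) := by
    rw [isDoubled_iff_conjSwap_eq] at h1 ⊢
    conv_rhs => rw [← h1]
    ext i j
    simp [conjSwap, Complex.conj_ofNat]
  simpa using h3.sub h2

variable {G} {V : Matrix (κ ⊕ κ) (κ ⊕ κ) ℂ} {P : Matrix (ι ⊕ ι) (ι ⊕ ι) ℂ}

theorem IsHurwitz.existsUnique_lyapunov (hG : G.IsHurwitz) (V : Matrix (κ ⊕ κ) (κ ⊕ κ) ℂ) :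
    ∃! P, G.Lyapunov V P := by
  obtain ⟨P, hP⟩ := IsStable.exists_lyapunov hG (flat G.C * (G.S * V * G.Sᴴ) * (flat G.C)ᴴ)
  refine ⟨P, hP, fun P' hP' => ?_⟩
  have h : G.A * (P' - P) + (P' - P) * G.Aᴴ = 0 := by
    have h1 := (show _ = _ from hP').trans (show _ = _ from hP).symm
    rw [add_left_inj] at h1
    rw [Matrix.mul_sub, Matrix.sub_mul, ← sub_eq_zero.2 h1]
    abel
  exact sub_eq_zero.1 (IsStable.lyapunov_unique hG h)

/-- `P - conjSwap P` and `J` solve the same Lyapunov equation, because the inputs `V` and `conjSwap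
V` differ by `J`; stability makes the solution unique. -/
theorem IsHurwitz.conjSwap_lyapunov (hG : G.IsHurwitz) (hV : conjSwap V = V - Jmat κ)
    (hP : G.Lyapunov V P) : conjSwap P = P - Jmat ι := by
  have h1 := congrArg conjSwap hP
  simp only [conjSwap_add, conjSwap_mul, conjSwap_conjTranspose, G.conjSwap_A,
    isDoubled_iff_conjSwap_eq.1 G.doubled_C.flat, G.symplectic_S.conjSwap_eq, hV,
    conjSwap_zero] at h1
  have h2 : G.A * (P - conjSwap P - Jmat ι) + (P - conjSwap P - Jmat ι) * G.Aᴴ = 0 := by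
    have h3 := G.A_mul_Jmat
    rw [Matrix.mul_sub, Matrix.sub_mul, G.symplectic_S.mul_Jmat_mul_conjTranspose, Matrix.mul_sub,
      Matrix.sub_mul] at h1
    unfold Lyapunov at hP
    calc _ = (G.A * P + P * G.Aᴴ + flat G.C * (G.S * V * G.Sᴴ) * (flat G.C)ᴴ)
          - (G.A * conjSwap P + conjSwap P * G.Aᴴ
            + (flat G.C * (G.S * V * G.Sᴴ) * (flat G.C)ᴴ - flat G.C * Jmat κ * (flat G.C)ᴴ))
          - (G.A * Jmat ι + Jmat ι * G.Aᴴ + flat G.C * Jmat κ * (flat G.C)ᴴ) := by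
          simp only [Matrix.mul_sub, Matrix.sub_mul]; abel
      _ = 0 := by rw [hP, h1, h3]; simp
  have h3 := IsStable.lyapunov_unique hG h2
  rw [sub_sub, sub_eq_zero] at h3
  exact eq_sub_of_add_eq h3.symm

theorem IsHurwitz.posSemidef_lyapunov (hG : G.IsHurwitz) (hV : V.PosSemidef)
    (hP : G.Lyapunov V P) : P.PosSemidef :=
  IsStable.posSemidef hG
    ((hV.mul_mul_conjTranspose_same G.S).mul_mul_conjTranspose_same (flat G.C)) hP

theorem conjTranspose_neg_star_smul_sub {a : Type*} [DecidableEq a] (A : Matrix a a ℂ) (s : ℂ) :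
    (-star s • (1 : Matrix a a ℂ) - A)ᴴ = -(s • 1 - -Aᴴ) := by
  rw [conjTranspose_sub, conjTranspose_smul, conjTranspose_one]
  simp
  abel

theorem IsRegularAt.isUnit_adjoint {s : ℂ} (hs : G.IsRegularAt (-star s)) :
    IsUnit (s • (1 : Matrix (ι ⊕ ι) (ι ⊕ ι) ℂ) - -G.Aᴴ) := by
  rw [← neg_neg (s • (1 : Matrix (ι ⊕ ι) (ι ⊕ ι) ℂ) - -G.Aᴴ), ← conjTranspose_neg_star_smul_sub]
  exact (IsUnit.star hs).neg

/-- The power spectrum splits into a constant, a stable and an antistable part. -/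
theorem powerSpectrum_eq (hP : G.Lyapunov V P) {s : ℂ} (hs : G.IsRegularAt s)
    (hs' : G.IsRegularAt (-star s)) :
    G.powerSpectrum V s = G.S * V * G.Sᴴ
      + G.C * (s • (1 : Matrix (ι ⊕ ι) (ι ⊕ ι) ℂ) - G.A)⁻¹
        * (P * G.Cᴴ - flat G.C * (G.S * V * G.Sᴴ))
      - (G.C * P - G.S * V * G.Sᴴ * (flat G.C)ᴴ)
        * (s • (1 : Matrix (ι ⊕ ι) (ι ⊕ ι) ℂ) - -G.Aᴴ)⁻¹ * G.Cᴴ := by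
  set W := G.S * V * G.Sᴴ with hW
  set B := flat G.C with hB
  set R := (s • (1 : Matrix (ι ⊕ ι) (ι ⊕ ι) ℂ) - G.A)⁻¹ with hR
  set R' := (s • (1 : Matrix (ι ⊕ ι) (ι ⊕ ι) ℂ) - -G.Aᴴ)⁻¹ with hR'
  have hu' := hs'.isUnit_adjoint
  have hinv : ((-star s • (1 : Matrix (ι ⊕ ι) (ι ⊕ ι) ℂ) - G.A)⁻¹)ᴴ = -R' := by
    rw [conjTranspose_nonsing_inv, conjTranspose_neg_star_smul_sub]
    refine inv_eq_left_inv ?_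
    rw [neg_mul_neg]
    exact nonsing_inv_mul _ ((Matrix.isUnit_iff_isUnit_det _).1 hu')
  have h1 : R * (s • (1 : Matrix (ι ⊕ ι) (ι ⊕ ι) ℂ) - G.A) = 1 :=
    nonsing_inv_mul _ ((Matrix.isUnit_iff_isUnit_det _).1 hs)
  have h2 : (s • (1 : Matrix (ι ⊕ ι) (ι ⊕ ι) ℂ) - -G.Aᴴ) * R' = 1 :=
    mul_nonsing_inv _ ((Matrix.isUnit_iff_isUnit_det _).1 hu')
  -- Written through `s - A` and `s + A†`, the noise term between the two resolvents separates into
  -- partial fractions.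
  have hQ : B * W * Bᴴ = (s • 1 - G.A) * P - P * (s • 1 - -G.Aᴴ) := by
    have : B * W * Bᴴ = -(G.A * P + P * G.Aᴴ) := eq_neg_of_add_eq_zero_right hP
    rw [this, Matrix.sub_mul, Matrix.mul_sub]
    simp
    abel
  have h3 : R * (B * W * Bᴴ) * R' = P * R' - R * P := by
    calc _ = (R * (s • 1 - G.A)) * P * R' - R * P * ((s • 1 - -G.Aᴴ) * R') := by
          rw [hQ]; noncomm_ring
      _ = _ := by rw [h1, h2, Matrix.one_mul, Matrix.mul_one]
  have h4 : G.powerSpectrum V s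
      = (1 - G.C * R * B) * W * (1 + Bᴴ * R' * G.Cᴴ) := by
    rw [powerSpectrum, transfer, transfer, conjTranspose_mul, conjTranspose_sub, conjTranspose_mul,
      conjTranspose_mul, conjTranspose_one, hinv, hW]
    simp only [Matrix.mul_assoc, Matrix.mul_neg, Matrix.neg_mul, sub_neg_eq_add]
    rfl
  have h5 : G.C * R * B * W * (Bᴴ * R' * G.Cᴴ) = G.C * P * R' * G.Cᴴ - G.C * R * P * G.Cᴴ := by
    calc _ = G.C * (R * (B * W * Bᴴ) * R') * G.Cᴴ := by simp only [Matrix.mul_assoc]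
      _ = _ := by rw [h3, Matrix.mul_sub, Matrix.sub_mul]; simp only [Matrix.mul_assoc]
  rw [h4, Matrix.sub_mul, Matrix.sub_mul, Matrix.one_mul, Matrix.mul_add, Matrix.mul_add,
    Matrix.mul_one, Matrix.mul_one, h5, Matrix.mul_sub, Matrix.sub_mul, Matrix.sub_mul]
  simp only [Matrix.mul_assoc]
  abel

theorem eventually_isRegularAt (G : QLS ι κ) :
    ∀ᶠ s in Bornology.cobounded ℂ, G.IsRegularAt s ∧ G.IsRegularAt (-star s) := by
  have h := eventually_isUnit_sub G.A
  refine h.and ?_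
  have ht : Filter.Tendsto (fun s : ℂ => -star s) (Bornology.cobounded ℂ)
      (Bornology.cobounded ℂ) := by
    rw [← tendsto_norm_atTop_iff_cobounded]
    simpa using tendsto_norm_cobounded_atTop (E := ℂ)
  exact ht.eventually h

/-- Field coordinates in which the input of the modes (behind the static component) is the
vacuum. -/
theorem vacuum_coordinates {ι : Type*} (G : QLS ι κ) {R : Matrix (κ ⊕ κ) (κ ⊕ κ) ℂ}
    (h : R * V * Rᴴ = vacuumCov κ) :
    R * flat G.S * (G.S * V * G.Sᴴ) * (R * flat G.S)ᴴ = vacuumCov κ := by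
  have h1 : G.Sᴴ * (flat G.S)ᴴ = 1 := by
    rw [← conjTranspose_mul, G.symplectic_S.flat_mul, conjTranspose_one]
  calc _ = R * (flat G.S * G.S) * V * (G.Sᴴ * (flat G.S)ᴴ) * Rᴴ := by
        rw [conjTranspose_mul]; simp only [Matrix.mul_assoc]
    _ = _ := by rw [h1, G.symplectic_S.flat_mul, Matrix.mul_one, Matrix.mul_one, h]

/-- A system whose stationary state has an invertible covariance is globally minimal. -/
theorem IsHurwitz.isGloballyMinimal_of_isUnit (hG : G.IsHurwitz)
    (hV : ∃ R, IsSymplectic R ∧ R * V * Rᴴ = vacuumCov κ) (hP : G.Lyapunov V P) (hu : IsUnit P) :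
    G.IsGloballyMinimal V := by
  obtain ⟨R, hR, hRV⟩ := hV
  intro k hk G' hG' hsame
  obtain ⟨P', hP', -⟩ := hG'.existsUnique_lyapunov V
  have hPpos := hG.posSemidef_lyapunov (hR.posSemidef_of_vacuumCov hRV) hP
  have hPc := hG.conjSwap_lyapunov (hR.conjSwap_of_conj conjSwap_vacuumCov hRV) hP
  have hVh := (hR.posSemidef_of_vacuumCov hRV).isHermitian
  -- Both power spectra are split; their stable parts must have the same Markov parameters.
  have hmarkov := stable_markov_eq_of_eventually_eq (A := G.A) (A' := G'.A) (B := -G.Aᴴ)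
    (B' := -G'.Aᴴ) hG hG' (by rw [neg_neg]; exact IsStable.conjTranspose hG)
    (by rw [neg_neg]; exact IsStable.conjTranspose hG')
    (X := G.C) (Y := P * G.Cᴴ - flat G.C * (G.S * V * G.Sᴴ))
    (X' := G'.C) (Y' := P' * G'.Cᴴ - flat G'.C * (G'.S * V * G'.Sᴴ))
    (L := -(G.C * P - G.S * V * G.Sᴴ * (flat G.C)ᴴ)) (M := G.Cᴴ)
    (L' := -(G'.C * P' - G'.S * V * G'.Sᴴ * (flat G'.C)ᴴ)) (M' := G'.Cᴴ)
    (D := G'.S * V * G'.Sᴴ - G.S * V * G.Sᴴ) (by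
      filter_upwards [G.eventually_isRegularAt, G'.eventually_isRegularAt] with s hs hs'
      have h1 := hsame s hs.1 hs.2 hs'.1 hs'.2
      rw [powerSpectrum_eq hP hs.1 hs.2, powerSpectrum_eq hP' hs'.1 hs'.2] at h1
      rw [← sub_eq_zero] at h1 ⊢
      rw [← h1]
      simp only [Matrix.neg_mul]
      abel)
  have hle := card_le_of_markov_eq
    (fun z x hx hC => eq_zero_of_eigenvector_of_mulVec_eq_zero hG G.A_add_flat_A hx hC)
    (fun z y hy hK => ?_) hmarkov
  · simp only [Fintype.card_sum, Fintype.card_fin] at hle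
    omega
  -- In the field coordinates `R S^♭` the modes see the vacuum, while `C^♭ C` and the noise term are
  -- unchanged.
  · set T := R * flat G.S with hT
    have hTs : IsSymplectic T := hR.mul G.symplectic_S.flat
    have hTV : T * (G.S * V * G.Sᴴ) * Tᴴ = vacuumCov κ := G.vacuum_coordinates hRV
    have hW := hTs.eq_flat_mul_mul hTV
    have hC : flat (T * G.C) = flat G.C * flat T := QuantumLinear.flat_mul _ _
    refine eq_zero_of_eigenvector_of_invertible_cov hG (C := T * G.C) ?_ ?_ hPc hu hy ?_
    · rw [hC, Matrix.mul_assoc, ← Matrix.mul_assoc (flat T), hTs.flat_mul, Matrix.one_mul]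
      exact G.A_add_flat_A
    · rw [hC, conjTranspose_mul]
      unfold Lyapunov at hP
      rw [hW] at hP
      simpa only [Matrix.mul_assoc] using hP
    · have hTT : T * (G.S * V * G.Sᴴ) = vacuumCov κ * (Jmat κ * T * Jmat κ) := by
        have h1 : Tᴴ * (flat T)ᴴ = 1 := by
          rw [← conjTranspose_mul, hTs.flat_mul, conjTranspose_one]
        rw [← flat_conjTranspose, ← hTV, Matrix.mul_assoc _ Tᴴ, h1, Matrix.mul_one]
      rw [conjTranspose_sub, conjTranspose_mul, conjTranspose_mul, conjTranspose_conjTranspose,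
        hPpos.isHermitian.eq, (isHermitian_mul_mul_conjTranspose _ hVh).eq, sub_mulVec,
        sub_eq_zero] at hK
      have h2 := congrArg (T *ᵥ ·) hK
      simp only [mulVec_mulVec] at h2 ⊢
      rw [Matrix.mul_assoc, h2, ← Matrix.mul_assoc T, hTT, flat_conjTranspose]
      congr 1
      simp only [Matrix.mul_assoc]
      rw [Jmat_mul_cancel, ← Matrix.mul_assoc (vacuumCov κ), vacuumCov_mul_Jmat]

end QLS

namespace QuantumLinear

/-! ### Coordinate inclusions and matrix entries. -/

section Inclusions

variable {α β γ : Type*} [DecidableEq α]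

/-- The matrix of the inclusion of coordinates `f`. -/
def incl (f : β → α) : Matrix α β ℂ := (1 : Matrix α α ℂ).submatrix id f

theorem mul_incl [Fintype α] (X : Matrix γ α ℂ) (f : β → α) : X * incl f = X.submatrix id f := by
  ext i j
  simp [incl, mul_apply, one_apply]

theorem incl_conjTranspose_mul [Fintype α] (X : Matrix α γ ℂ) (f : β → α) :
    (incl f)ᴴ * X = X.submatrix f id := by
  ext i j
  simp [incl, mul_apply, one_apply]

theorem incl_mul_submatrix [Fintype β] (X : Matrix α γ ℂ) {f : β → α} (hf : Function.Injective f)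
    (h : ∀ x, x ∉ Set.range f → ∀ y, X x y = 0) : incl f * X.submatrix f id = X := by
  ext x y
  by_cases hx : x ∈ Set.range f
  · obtain ⟨v, rfl⟩ := hx
    classical
    simp [incl, mul_apply, one_apply, hf.eq_iff]
  · rw [h x hx y]
    refine Finset.sum_eq_zero fun v _ => ?_
    have : x ≠ f v := fun h => hx ⟨v, h.symm⟩
    simp [incl, this]

theorem incl_conjTranspose_mul_incl [Fintype α] [DecidableEq β] {f : β → α}
    (hf : Function.Injective f) : (incl f)ᴴ * incl f = 1 := by
  rw [incl_conjTranspose_mul]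
  ext i j
  simp [incl, one_apply, hf.eq_iff]

/-- The selected coordinates span an invariant subspace, so eigenvectors of the block, extended by
zero, are eigenvectors of `A`. -/
theorem isStable_submatrix [Fintype α] [Fintype β] [DecidableEq β] {A : Matrix α α ℂ}
    (hA : IsStable A) {f : β → α} (hf : Function.Injective f)
    (h : ∀ x, x ∉ Set.range f → ∀ y, A x (f y) = 0) : IsStable (A.submatrix f f) := by
  intro z hz
  obtain ⟨x, hx, hxz⟩ := mem_spectrum_iff_exists_eigenvector.1 hz
  refine hA z (mem_spectrum_iff_exists_eigenvector.2 ⟨incl f *ᵥ x, fun h0 => hx ?_, ?_⟩)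
  · rw [← one_mulVec x, ← incl_conjTranspose_mul_incl hf, ← mulVec_mulVec, h0, mulVec_zero]
  · have h1 := incl_mul_submatrix (A.submatrix id f) hf h
    rw [mulVec_mulVec, mul_incl, ← h1, ← mulVec_mulVec, submatrix_submatrix]
    erw [hxz]
    rw [mulVec_smul]

theorem inv_mul_eq_mul_inv [Fintype α] [Fintype β] [DecidableEq β] {X : Matrix α α ℂ}
    {Y : Matrix β β ℂ} {E : Matrix α β ℂ} (hX : IsUnit X) (hY : IsUnit Y) (h : X * E = E * Y) :
    X⁻¹ * E = E * Y⁻¹ := by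
  rw [Matrix.isUnit_iff_isUnit_det] at hX hY
  calc X⁻¹ * E = X⁻¹ * (E * Y) * Y⁻¹ := by
        rw [Matrix.mul_assoc, Matrix.mul_assoc, mul_nonsing_inv _ hY, Matrix.mul_one]
    _ = _ := by rw [← h, ← Matrix.mul_assoc, nonsing_inv_mul _ hX, Matrix.one_mul]

end Inclusions

section Entries

variable {α β γ δ : Type*} [Fintype α] [DecidableEq α] [Fintype β] [DecidableEq β]

theorem apply_eq_star_apply_swap {α β : Type*} {X : Matrix (α ⊕ α) (β ⊕ β) ℂ}
    (hX : conjSwap X = X) (x : α ⊕ α) (y : β ⊕ β) : X x y = star (X x.swap y.swap) := by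
  conv_lhs => rw [← hX]
  rfl

/-- The diagonal `(1, -1)` of `Jmat`. -/
def signJ (α : Type*) : α ⊕ α → ℂ := Sum.elim 1 (-1)

theorem Jmat_eq_diagonal {α : Type*} [DecidableEq α] : Jmat α = diagonal (signJ α) := by
  ext (i | i) (j | j) <;> by_cases h : i = j <;> simp [Jmat, signJ, h]

theorem flat_apply (Z : Matrix (α ⊕ α) (β ⊕ β) ℂ) (x : β ⊕ β) (y : α ⊕ α) :
    flat Z x y = signJ β x * star (Z y x) * signJ α y := by
  rw [flat, Jmat_eq_diagonal, Jmat_eq_diagonal, mul_diagonal, diagonal_mul, conjTranspose_apply]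

theorem flat_submatrix [Fintype γ] [DecidableEq γ] (Z : Matrix (α ⊕ α) (β ⊕ β) ℂ) (f : γ → β) :
    flat (Z.submatrix id (Sum.map f f)) = (flat Z).submatrix (Sum.map f f) id := by
  ext (x | x) y <;> simp [flat_apply, signJ]

theorem Jmat_mul_submatrix [Fintype γ] [DecidableEq γ] (Z : Matrix (β ⊕ β) δ ℂ) (f : γ → β)
    {ε : Type*} (g : ε → δ) :
    Jmat γ * Z.submatrix (Sum.map f f) g = (Jmat β * Z).submatrix (Sum.map f f) g := by
  ext (x | x) y <;> simp [Jmat_eq_diagonal, signJ, diagonal_mul]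

/-- The diagonal of `thermalCov`. -/
def thermalDiag (ν : α → ℝ) : α ⊕ α → ℂ := Sum.elim (fun i => (ν i : ℂ) + 1) fun i => (ν i : ℂ)

theorem thermalCov_eq_diagonal {α : Type*} [DecidableEq α] (ν : α → ℝ) : thermalCov ν = diagonal (thermalDiag ν) := by
  rw [thermalCov, fromBlocks_diagonal]
  rfl

theorem thermalCov_conjTranspose {α : Type*} [DecidableEq α] (ν : α → ℝ) : (thermalCov ν)ᴴ = thermalCov ν := by
  rw [thermalCov_eq_diagonal, diagonal_conjTranspose]
  congr 1
  ext (i | i) <;> simp [thermalDiag]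

theorem isUnit_thermalCov_iff {ν : α → ℝ} (h : ∀ i, 0 ≤ ν i) :
    IsUnit (thermalCov ν) ↔ ∀ i, ν i ≠ 0 := by
  rw [thermalCov_eq_diagonal, isUnit_diagonal, Pi.isUnit_iff]
  simp only [isUnit_iff_ne_zero, Sum.forall, thermalDiag, Sum.elim_inl, Sum.elim_inr]
  constructor
  · exact fun h' i => by exact_mod_cast h'.2 i
  · refine fun h' => ⟨fun i => ?_, fun i => by exact_mod_cast h' i⟩
    exact_mod_cast (add_pos_of_nonneg_of_pos (h i) one_pos).ne'

end Entries

end QuantumLinear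

/-! ### Restrictions, changes of mode coordinates and intertwiners. -/

namespace QLS

open scoped ComplexOrder

variable {ι ι' κ : Type*} [Fintype ι] [DecidableEq ι] [Fintype ι'] [DecidableEq ι']
  [Fintype κ] [DecidableEq κ] {G : QLS ι κ} {V : Matrix (κ ⊕ κ) (κ ⊕ κ) ℂ}

theorem restrict_C {ι ι' : Type*} (G : QLS ι κ) (f : ι' → ι) :
    (G.restrict f).C = G.C.submatrix id (Sum.map f f) := by
  simp [restrict]

theorem restrict_A (G : QLS ι κ) (f : ι' → ι) :
    (G.restrict f).A = G.A.submatrix (Sum.map f f) (Sum.map f f) := by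
  have h1 : flat (G.restrict f).C * (G.restrict f).C
      = (flat G.C * G.C).submatrix (Sum.map f f) (Sum.map f f) := by
    rw [restrict_C, flat_submatrix]
    rfl
  rw [A, h1]
  have h2 : Jmat ι' * (G.restrict f).Ω = (Jmat ι * G.Ω).submatrix (Sum.map f f) (Sum.map f f) :=
    Jmat_mul_submatrix _ _ _
  rw [h2]
  rfl

theorem dropStatic_A (G : QLS ι κ) : G.dropStatic.A = G.A := by
  have h : flat (flat G.S * G.C) * (flat G.S * G.C) = flat G.C * G.C := by
    rw [QuantumLinear.flat_mul, flat_flat, Matrix.mul_assoc, ← Matrix.mul_assoc G.S,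
      G.symplectic_S.mul_flat, Matrix.one_mul]
  rw [A, A]
  simp only [dropStatic]
  rw [h]

section changeBasis

variable {T : Matrix (ι ⊕ ι) (ι ⊕ ι) ℂ} (hT : IsSymplectic T)

include hT

theorem changeBasis_C (G : QLS ι κ) : (G.changeBasis hT).C = G.C * flat T := rfl

theorem flat_changeBasis_C (G : QLS ι κ) : flat (G.changeBasis hT).C = T * flat G.C := by
  rw [changeBasis, QuantumLinear.flat_mul, flat_flat]

theorem changeBasis_A (G : QLS ι κ) : (G.changeBasis hT).A = T * G.A * flat T := by
  have h1 : Jmat ι * ((flat T)ᴴ * G.Ω * flat T) = T * (Jmat ι * G.Ω) * flat T := by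
    rw [flat_conjTranspose]
    simp only [Matrix.mul_assoc]
    rw [Jmat_mul_cancel]
  rw [A, A, flat_changeBasis_C]
  simp only [changeBasis]
  rw [h1]
  simp only [Matrix.mul_sub, Matrix.sub_mul, Matrix.mul_neg, Matrix.neg_mul, Matrix.mul_smul,
    Matrix.smul_mul, Matrix.mul_assoc]

theorem IsHurwitz.changeBasis (hG : G.IsHurwitz) : (G.changeBasis hT).IsHurwitz := by
  intro z hz
  obtain ⟨x, hx, hxz⟩ := mem_spectrum_iff_exists_eigenvector.1 hz
  refine hG z (mem_spectrum_iff_exists_eigenvector.2 ⟨flat T *ᵥ x, fun h0 => hx ?_, ?_⟩)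
  · rw [← one_mulVec x, ← hT.mul_flat, ← mulVec_mulVec, h0, mulVec_zero]
  · have h1 := congrArg (flat T *ᵥ ·) hxz
    simp only [changeBasis_A, mulVec_mulVec, mulVec_smul] at h1
    rw [mulVec_mulVec, ← h1, ← Matrix.mul_assoc, ← Matrix.mul_assoc, hT.flat_mul, Matrix.one_mul]

theorem Lyapunov.changeBasis {P : Matrix (ι ⊕ ι) (ι ⊕ ι) ℂ} (hP : G.Lyapunov V P) :
    (G.changeBasis hT).Lyapunov V (T * P * Tᴴ) := by
  have h1 : Tᴴ * (flat T)ᴴ = 1 := by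
    rw [← conjTranspose_mul, hT.flat_mul, conjTranspose_one]
  have h2 := congrArg (fun X => T * X * Tᴴ) (show _ = _ from hP)
  unfold Lyapunov
  rw [changeBasis_A, flat_changeBasis_C]
  simp only [Matrix.mul_zero, Matrix.zero_mul] at h2
  rw [← h2]
  simp only [Matrix.mul_add, Matrix.add_mul]
  congr 1
  · congr 1
    · calc _ = T * G.A * (flat T * T) * P * Tᴴ := by simp only [Matrix.mul_assoc]
        _ = _ := by rw [hT.flat_mul, Matrix.mul_one]; simp only [Matrix.mul_assoc]
    · calc _ = T * P * (Tᴴ * (flat T)ᴴ) * G.Aᴴ * Tᴴ := by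
            simp only [conjTranspose_mul, Matrix.mul_assoc]
        _ = _ := by rw [h1, Matrix.mul_one]; simp only [Matrix.mul_assoc]
  · simp only [QLS.changeBasis, conjTranspose_mul, Matrix.mul_assoc]

end changeBasis

/-- Systems related by an intertwiner `E` of their state spaces have the same power spectrum. -/
theorem samePowerSpectrum_of_intertwiner {G' : QLS ι' κ} {P : Matrix (ι ⊕ ι) (ι ⊕ ι) ℂ}
    {P' : Matrix (ι' ⊕ ι') (ι' ⊕ ι') ℂ} (hV : V.IsHermitian) (hPh : P.IsHermitian)
    (hPh' : P'.IsHermitian) (hP : G.Lyapunov V P) (hP' : G'.Lyapunov V P')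
    (E : Matrix (ι ⊕ ι) (ι' ⊕ ι') ℂ) (hS : G'.S = G.S) (hA : G.A * E = E * G'.A)
    (hC : G.C * E = G'.C)
    (hK : P * G.Cᴴ - flat G.C * (G.S * V * G.Sᴴ)
      = E * (P' * G'.Cᴴ - flat G'.C * (G'.S * V * G'.Sᴴ))) : SamePowerSpectrum G G' V := by
  intro s h1 h2 h3 h4
  have hW : (G.S * V * G.Sᴴ)ᴴ = G.S * V * G.Sᴴ := isHermitian_mul_mul_conjTranspose _ hV
  rw [powerSpectrum_eq hP h1 h2, powerSpectrum_eq hP' h3 h4]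
  -- The adjoint of `hK`: the antistable part is intertwined by `E†`.
  have hL : G.C * P - G.S * V * G.Sᴴ * (flat G.C)ᴴ
      = (G'.C * P' - G'.S * V * G'.Sᴴ * (flat G'.C)ᴴ) * Eᴴ := by
    have h := congrArg Matrix.conjTranspose hK
    rw [conjTranspose_mul, conjTranspose_sub, conjTranspose_sub, conjTranspose_mul P,
      conjTranspose_mul P', conjTranspose_mul (flat G.C), conjTranspose_mul (flat G'.C), hS, hW,
      hPh.eq, hPh'.eq,
      conjTranspose_conjTranspose, conjTranspose_conjTranspose] at h
    rw [h, hS]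
  have hR : (s • (1 : Matrix (ι ⊕ ι) (ι ⊕ ι) ℂ) - G.A)⁻¹ * E
      = E * (s • (1 : Matrix (ι' ⊕ ι') (ι' ⊕ ι') ℂ) - G'.A)⁻¹ := by
    refine inv_mul_eq_mul_inv h1 h3 ?_
    rw [Matrix.sub_mul, Matrix.mul_sub, hA]
    simp
  have hR' : (s • (1 : Matrix (ι' ⊕ ι') (ι' ⊕ ι') ℂ) - -G'.Aᴴ)⁻¹ * Eᴴ
      = Eᴴ * (s • (1 : Matrix (ι ⊕ ι) (ι ⊕ ι) ℂ) - -G.Aᴴ)⁻¹ := by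
    refine inv_mul_eq_mul_inv h4.isUnit_adjoint h2.isUnit_adjoint ?_
    have hA' := congrArg Matrix.conjTranspose hA
    rw [conjTranspose_mul, conjTranspose_mul] at hA'
    rw [Matrix.sub_mul, Matrix.mul_sub, Matrix.mul_neg, Matrix.neg_mul, hA']
    simp
  rw [hK, hL, hS, ← hC, conjTranspose_mul]
  congr 1
  · congr 1
    rw [← Matrix.mul_assoc, Matrix.mul_assoc G.C, hR]
    simp only [Matrix.mul_assoc]
  · rw [Matrix.mul_assoc _ Eᴴ, ← hR']
    simp only [Matrix.mul_assoc]

/-! ### Vanishing entries at a pure mode. -/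

section ThermalState

variable {ν : ι → ℝ} {R : Matrix (κ ⊕ κ) (κ ⊕ κ) ℂ}

theorem Lyapunov.thermal_apply (hP : G.Lyapunov V (thermalCov ν)) (x y : ι ⊕ ι) :
    G.A x y * thermalDiag ν y + thermalDiag ν x * star (G.A y x)
      + (flat G.C * (G.S * V * G.Sᴴ) * (flat G.C)ᴴ) x y = 0 := by
  have h := congrFun (congrFun (show _ = _ from hP) x) y
  rwa [Matrix.add_apply, Matrix.add_apply, thermalCov_eq_diagonal, mul_diagonal, diagonal_mul,
    conjTranspose_apply] at h

/-- The vacuum covariance is a projection, so the noise term takes the form `X X†`, whose diagonal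
entries are sums of squares. -/
theorem input_covariance_eq (hR : IsSymplectic R) (hRV : R * V * Rᴴ = vacuumCov κ) :
    flat G.C * (G.S * V * G.Sᴴ) * (flat G.C)ᴴ
      = flat (R * flat G.S * G.C) * vacuumCov κ * (flat (R * flat G.S * G.C) * vacuumCov κ)ᴴ := by
  have hU : IsSymplectic (R * flat G.S) := hR.mul G.symplectic_S.flat
  have h : flat (R * flat G.S * G.C) * vacuumCov κ * (flat (R * flat G.S * G.C) * vacuumCov κ)ᴴ
      = flat (R * flat G.S * G.C) * vacuumCov κ * (flat (R * flat G.S * G.C))ᴴ := by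
    rw [conjTranspose_mul, vacuumCov_conjTranspose, ← Matrix.mul_assoc,
      Matrix.mul_assoc _ (vacuumCov κ) (vacuumCov κ), vacuumCov_mul_self]
  rw [h, hU.eq_flat_mul_mul (G.vacuum_coordinates hRV), QuantumLinear.flat_mul _ G.C,
    conjTranspose_mul (flat G.C)]
  simp only [Matrix.mul_assoc]

theorem mul_vacuumCov_apply_inl {α : Type*} (X : Matrix α (κ ⊕ κ) ℂ) (x : α) (k : κ) :
    (X * vacuumCov κ) x (Sum.inl k) = X x (Sum.inl k) := by
  rw [vacuumCov, thermalCov_eq_diagonal, mul_diagonal]; simp [thermalDiag]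

theorem mul_vacuumCov_apply_inr {α : Type*} (X : Matrix α (κ ⊕ κ) ℂ) (x : α) (k : κ) :
    (X * vacuumCov κ) x (Sum.inr k) = 0 := by
  rw [vacuumCov, thermalCov_eq_diagonal, mul_diagonal]; simp [thermalDiag]

variable (hP : G.Lyapunov V (thermalCov ν)) (hR : IsSymplectic R)
  (hRV : R * V * Rᴴ = vacuumCov κ) {i : ι} (hi : ν i = 0)

include hP hR hRV hi

/-- At the creation diagonal entry of a pure mode both drift terms carry the factor `ν i = 0`. What
is left is a sum of squares equal to zero. -/
theorem Lyapunov.noise_row_eq_zero (w : κ ⊕ κ) :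
    (flat (R * flat G.S * G.C) * vacuumCov κ) (Sum.inr i) w = 0 := by
  have h := hP.thermal_apply (Sum.inr i) (Sum.inr i)
  rw [input_covariance_eq hR hRV, thermalDiag, Sum.elim_inr, hi, Complex.ofReal_zero, mul_zero,
    zero_mul, zero_add, zero_add, mul_apply] at h
  simp only [conjTranspose_apply] at h
  have h1 := (Finset.sum_eq_zero_iff_of_nonneg fun w _ => mul_star_self_nonneg _).1 h w
    (Finset.mem_univ w)
  simpa using h1

/-- Without noise and with `ν i = 0`, the `(i, y)` entry of the equation reduces to `A i y` times
the variance of `y`. -/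
theorem Lyapunov.drift_row_eq_zero {y : ι ⊕ ι} (hy : thermalDiag ν y ≠ 0) :
    G.A (Sum.inr i) y = 0 := by
  have h := hP.thermal_apply (Sum.inr i) y
  rw [input_covariance_eq hR hRV, mul_apply, Finset.sum_eq_zero fun w _ => by
    rw [hP.noise_row_eq_zero hR hRV hi, zero_mul], thermalDiag, Sum.elim_inr, hi,
    Complex.ofReal_zero, zero_mul, add_zero, add_zero] at h
  exact (mul_eq_zero.1 h).resolve_right hy

theorem Lyapunov.drift_creation_annihilation (hν : ∀ j, 0 ≤ ν j) (j : ι) :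
    G.A (Sum.inr i) (Sum.inl j) = 0 := by
  refine hP.drift_row_eq_zero hR hRV hi ?_
  rw [thermalDiag, Sum.elim_inl]
  exact_mod_cast (add_pos_of_nonneg_of_pos (hν j) one_pos).ne'

theorem Lyapunov.drift_annihilation_creation (hν : ∀ j, 0 ≤ ν j) (j : ι) :
    G.A (Sum.inl i) (Sum.inr j) = 0 := by
  rw [apply_eq_star_apply_swap G.conjSwap_A, star_eq_zero]
  exact hP.drift_creation_annihilation hR hRV hi hν j

theorem Lyapunov.drift_creation_creation {j : ι} (hj : ν j ≠ 0) :
    G.A (Sum.inr i) (Sum.inr j) = 0 := by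
  refine hP.drift_row_eq_zero hR hRV hi ?_
  rw [thermalDiag, Sum.elim_inr]
  exact_mod_cast hj

theorem Lyapunov.drift_annihilation_annihilation {j : ι} (hj : ν j ≠ 0) :
    G.A (Sum.inl i) (Sum.inl j) = 0 := by
  rw [apply_eq_star_apply_swap G.conjSwap_A, star_eq_zero]
  exact hP.drift_creation_creation hR hRV hi hj

theorem Lyapunov.coupling_annihilation_creation (k : κ) :
    (R * flat G.S * G.C) (Sum.inl k) (Sum.inr i) = 0 := by
  have h := hP.noise_row_eq_zero hR hRV hi (Sum.inl k)
  rw [mul_vacuumCov_apply_inl, flat_apply] at h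
  simpa [signJ] using h

theorem Lyapunov.coupling_creation_annihilation (k : κ) :
    (R * flat G.S * G.C) (Sum.inr k) (Sum.inl i) = 0 := by
  have hd := isDoubled_iff_conjSwap_eq.1 ((hR.mul G.symplectic_S.flat).doubled.mul G.doubled_C)
  rw [apply_eq_star_apply_swap hd, star_eq_zero]
  exact hP.coupling_annihilation_creation hR hRV hi k

/-- A pure mode does not contribute to the input matrix of the stable part of the power
spectrum. -/
theorem Lyapunov.input_row_eq_zero (w : κ ⊕ κ) :
    (thermalCov ν * G.Cᴴ - flat G.C * (G.S * V * G.Sᴴ)) (Sum.inl i) w = 0 ∧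
      (thermalCov ν * G.Cᴴ - flat G.C * (G.S * V * G.Sᴴ)) (Sum.inr i) w = 0 := by
  have hU : IsSymplectic (R * flat G.S) := hR.mul G.symplectic_S.flat
  set U := R * flat G.S with hUdef
  have h1 : Uᴴ * (flat U)ᴴ = 1 := by
    rw [← conjTranspose_mul, hU.flat_mul, conjTranspose_one]
  -- In vacuum field coordinates the rows can be compared entry by entry; the invertible factor on
  -- the right is harmless.
  have h2 : thermalCov ν * G.Cᴴ - flat G.C * (G.S * V * G.Sᴴ)
      = (thermalCov ν * (U * G.C)ᴴ - flat (U * G.C) * vacuumCov κ) * (flat U)ᴴ := by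
    rw [hU.eq_flat_mul_mul (G.vacuum_coordinates hRV), conjTranspose_mul U,
      QuantumLinear.flat_mul U, Matrix.sub_mul]
    congr 1
    · simp only [Matrix.mul_assoc]
      rw [h1, Matrix.mul_one]
    · simp only [Matrix.mul_assoc]
  have hrow : ∀ x, (∀ w, (thermalCov ν * (U * G.C)ᴴ - flat (U * G.C) * vacuumCov κ) x w = 0) →
      (thermalCov ν * G.Cᴴ - flat G.C * (G.S * V * G.Sᴴ)) x w = 0 := by
    intro x hx
    rw [h2, mul_apply]
    exact Finset.sum_eq_zero fun v _ => by rw [hx v, zero_mul]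
  constructor
  · refine hrow _ ?_
    rintro (k | k)
    -- Here `ν i + 1 = 1`, so `C†` and `C^♭` agree on annihilation entries and cancel; on creation
    -- channels the coupling vanishes.
    · rw [Matrix.sub_apply, mul_vacuumCov_apply_inl, thermalCov_eq_diagonal, diagonal_mul,
        conjTranspose_apply, flat_apply]
      simp [thermalDiag, hi, signJ]
    · rw [Matrix.sub_apply, mul_vacuumCov_apply_inr, thermalCov_eq_diagonal, diagonal_mul,
        conjTranspose_apply, hP.coupling_creation_annihilation hR hRV hi k]
      simp
  · refine hrow _ fun v => ?_
    rw [Matrix.sub_apply, hP.noise_row_eq_zero hR hRV hi v, thermalCov_eq_diagonal, diagonal_mul]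
    simp [thermalDiag, hi]

end ThermalState

/-! ### Restriction to the pure and to the mixed modes. -/

section Components

/-- `Sum.elim ν ν` assigns to both coordinates of a mode its photon number, which allows
annihilation and creation coordinates to be treated together. -/
theorem elim_eq_zero_of_notMem_range {ι ι' : Type*} {ν : ι → ℝ} {f : ι' → ι}
    (hr : ∀ i, ν i ≠ 0 → i ∈ Set.range f) {x : ι ⊕ ι}
    (hx : x ∉ Set.range (Sum.map f f)) : Sum.elim ν ν x = 0 := by
  by_contra h
  apply hx
  rcases x with i | i
  · obtain ⟨j, rfl⟩ := hr i h
    exact ⟨Sum.inl j, rfl⟩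
  · obtain ⟨j, rfl⟩ := hr i h
    exact ⟨Sum.inr j, rfl⟩

/-- For diagonal covariance the `(x, y)` entry of the equation involves only the drift entries `(x,
y)` and `(y, x)`, so it survives restriction to any modes. -/
theorem Lyapunov.restrict {ν : ι → ℝ} (hP : G.Lyapunov V (thermalCov ν)) (f : ι' → ι) :
    (G.restrict f).Lyapunov V (thermalCov fun i => ν (f i)) := by
  have hd : ∀ x, thermalDiag (fun i => ν (f i)) x = thermalDiag ν (Sum.map f f x) := by
    rintro (x | x) <;> rfl
  have hB : flat (G.restrict f).C = (flat G.C).submatrix (Sum.map f f) id := by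
    rw [← flat_submatrix, restrict_C]
  unfold Lyapunov
  rw [restrict_A, hB, thermalCov_eq_diagonal]
  ext x y
  have h := hP.thermal_apply (Sum.map f f x) (Sum.map f f y)
  rw [Matrix.add_apply, Matrix.add_apply, mul_diagonal, diagonal_mul, hd, hd, conjTranspose_apply]
  exact h

variable {ν : ι → ℝ} {R : Matrix (κ ⊕ κ) (κ ⊕ κ) ℂ} (hP : G.Lyapunov V (thermalCov ν))
  (hR : IsSymplectic R) (hRV : R * V * Rᴴ = vacuumCov κ) (hν : ∀ i, 0 ≤ ν i)

include hP hR hRV hν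

/-- Makes the drift block triangular. Both the stability of the components and the cascade structure
rest on this. -/
theorem Lyapunov.drift_pure_mixed {x y : ι ⊕ ι} (hx : Sum.elim ν ν x = 0)
    (hy : Sum.elim ν ν y ≠ 0) : G.A x y = 0 := by
  rcases x with i | i <;> rcases y with j | j
  · exact hP.drift_annihilation_annihilation hR hRV hx hy
  · exact hP.drift_annihilation_creation hR hRV hx hν j
  · exact hP.drift_creation_annihilation hR hRV hx hν j
  · exact hP.drift_creation_creation hR hRV hx hy

variable {f : ι' → ι} (hf : Function.Injective f)

include hf

theorem IsHurwitz.restrict_mixed (hG : G.IsHurwitz) (hr : ∀ i, ν i ≠ 0 → i ∈ Set.range f)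
    (hr' : ∀ j, ν (f j) ≠ 0) : (G.restrict f).IsHurwitz := by
  unfold IsHurwitz
  rw [restrict_A]
  refine isStable_submatrix hG (Sum.map_injective.2 ⟨hf, hf⟩) fun x hx y => ?_
  refine hP.drift_pure_mixed hR hRV hν (elim_eq_zero_of_notMem_range hr hx) ?_
  rcases y with y | y <;> exact hr' y

/-- The pure coordinates need not be invariant under `A`, but they are under `A†`, which is stable
too. -/
theorem IsHurwitz.restrict_pure (hG : G.IsHurwitz) (hr : ∀ i, ν i = 0 → i ∈ Set.range f)
    (hr' : ∀ j, ν (f j) = 0) : (G.restrict f).IsHurwitz := by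
  have h : IsStable (G.Aᴴ.submatrix (Sum.map f f) (Sum.map f f)) := by
    refine isStable_submatrix (IsStable.conjTranspose hG) (Sum.map_injective.2 ⟨hf, hf⟩)
      fun x hx y => ?_
    rw [conjTranspose_apply, star_eq_zero]
    refine hP.drift_pure_mixed hR hRV hν ?_ fun h0 => hx ?_
    · rcases y with y | y <;> exact hr' y
    · rcases x with x | x
      · obtain ⟨j, rfl⟩ := hr x h0
        exact ⟨Sum.inl j, rfl⟩
      · obtain ⟨j, rfl⟩ := hr x h0
        exact ⟨Sum.inr j, rfl⟩
  unfold IsHurwitz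
  rw [restrict_A]
  have h' := h.conjTranspose
  rwa [conjTranspose_submatrix, conjTranspose_conjTranspose] at h'

end Components

end QLS

/-! ### Deleting the pure modes, and the criterion for global minimality. -/

namespace QLS

open scoped ComplexOrder

variable {ι ι' κ : Type*} [Fintype ι] [DecidableEq ι] [Fintype ι'] [DecidableEq ι']
  [Fintype κ] [DecidableEq κ] {G : QLS ι κ} {V R : Matrix (κ ⊕ κ) (κ ⊕ κ) ℂ}
  {P T : Matrix (ι ⊕ ι) (ι ⊕ ι) ℂ} {ν : ι → ℝ}

theorem Lyapunov.canonical (hP : G.Lyapunov V P) (h : IsCanonicalBasis P T ν) :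
    (G.changeBasis h.symplectic).Lyapunov V (thermalCov ν) := by
  rw [← h.cov_eq]
  exact hP.changeBasis h.symplectic

variable {f : ι' → ι}

/-- Deleting pure modes does not change the power spectrum. -/
theorem Lyapunov.samePowerSpectrum_restrict (hP : G.Lyapunov V P) (hPh : P.IsHermitian)
    (h : IsCanonicalBasis P T ν) (hR : IsSymplectic R) (hRV : R * V * Rᴴ = vacuumCov κ)
    (hf : Function.Injective f) (hr : ∀ i, ν i ≠ 0 → i ∈ Set.range f)
    (hr' : ∀ j, ν (f j) ≠ 0) :
    SamePowerSpectrum G ((G.changeBasis h.symplectic).restrict f) V := by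
  have hT := h.symplectic
  have hP₁ := hP.canonical h
  have hF : Function.Injective (Sum.map f f) := Sum.map_injective.2 ⟨hf, hf⟩
  have hTT : Tᴴ * (flat T)ᴴ = 1 := by
    rw [← conjTranspose_mul, hT.flat_mul, conjTranspose_one]
  -- The intertwiner includes the kept modes and then returns to the original coordinates.
  refine samePowerSpectrum_of_intertwiner (hR.posSemidef_of_vacuumCov hRV).isHermitian hPh
    (thermalCov_conjTranspose _) hP (hP₁.restrict f) (flat T * incl (Sum.map f f)) rfl ?_ ?_ ?_
  · have h1 : G.A * flat T = flat T * (G.changeBasis hT).A := by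
      rw [changeBasis_A, ← Matrix.mul_assoc, ← Matrix.mul_assoc, hT.flat_mul, Matrix.one_mul]
    have h2 : (G.changeBasis hT).A * incl (Sum.map f f)
        = incl (Sum.map f f) * ((G.changeBasis hT).restrict f).A := by
      rw [mul_incl, restrict_A]
      symm
      refine incl_mul_submatrix ((G.changeBasis hT).A.submatrix id (Sum.map f f)) hF
        fun x hx y => ?_
      refine hP₁.drift_pure_mixed hR hRV h.nonneg (elim_eq_zero_of_notMem_range hr hx) ?_
      rcases y with y | y <;> exact hr' y
    rw [← Matrix.mul_assoc, h1, Matrix.mul_assoc, h2, Matrix.mul_assoc]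
  · rw [← Matrix.mul_assoc, mul_incl, restrict_C, changeBasis_C]
  · have h1 : P * G.Cᴴ - flat G.C * (G.S * V * G.Sᴴ)
        = flat T * (thermalCov ν * (G.changeBasis hT).Cᴴ
          - flat (G.changeBasis hT).C * (G.S * V * G.Sᴴ)) := by
      rw [← h.cov_eq, flat_changeBasis_C, Matrix.mul_sub]
      congr 1
      · calc P * G.Cᴴ = (flat T * T) * P * (Tᴴ * (flat T)ᴴ) * G.Cᴴ := by
              rw [hTT, hT.flat_mul, Matrix.one_mul, Matrix.mul_one]
          _ = _ := by simp only [changeBasis_C, conjTranspose_mul, Matrix.mul_assoc]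
      · rw [← Matrix.mul_assoc (flat T), ← Matrix.mul_assoc (flat T), hT.flat_mul, Matrix.one_mul]
    rw [h1, Matrix.mul_assoc (flat T)]
    congr 1
    rw [← incl_mul_submatrix (thermalCov ν * (G.changeBasis hT).Cᴴ
          - flat (G.changeBasis hT).C * (G.S * V * G.Sᴴ)) hF fun x hx y => ?_]
    · congr 1
      rw [restrict_C, flat_submatrix, thermalCov_eq_diagonal, thermalCov_eq_diagonal]
      ext (x | x) y
      · rw [submatrix_apply, Matrix.sub_apply, Matrix.sub_apply, diagonal_mul, diagonal_mul]
        rfl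
      · rw [submatrix_apply, Matrix.sub_apply, Matrix.sub_apply, diagonal_mul, diagonal_mul]
        rfl
    -- The deleted rows of the input matrix belong to pure modes and vanish.
    · have h0 := elim_eq_zero_of_notMem_range hr hx
      rcases x with x | x
      · exact (hP₁.input_row_eq_zero hR hRV h0 y).1
      · exact (hP₁.input_row_eq_zero hR hRV h0 y).2

theorem _root_.QuantumLinear.IsCanonicalBasis.isUnit_iff (h : IsCanonicalBasis P T ν) :
    IsUnit P ↔ ∀ i, ν i ≠ 0 := by
  rw [← isUnit_thermalCov_iff h.nonneg, ← h.cov_eq]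
  have hT := h.symplectic.isUnit
  constructor
  · exact fun hP => (hT.mul hP).mul hT.star
  · intro hu
    rw [Matrix.isUnit_iff_isUnit_det] at hu ⊢
    rw [det_mul, det_mul] at hu
    exact isUnit_of_mul_isUnit_right (isUnit_of_mul_isUnit_left hu)

/-- Full mixedness amounts to invertibility of `P`, so it can be tested in any one canonical basis.
-/
theorem _root_.QuantumLinear.IsCanonicalBasis.isFullyMixed_iff (h : IsCanonicalBasis P T ν) :
    IsFullyMixed P ↔ ∀ i, ν i ≠ 0 := by
  constructor
  · rintro ⟨T', ν', h', hpos⟩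
    exact h.isUnit_iff.1 (h'.isUnit_iff.2 fun i => (hpos i).ne')
  · exact fun hne => ⟨T, ν, h, fun i => lt_of_le_of_ne (h.nonneg i) (hne i).symm⟩

theorem IsHurwitz.isGloballyMinimal_restrict (hG : G.IsHurwitz) (hP : G.Lyapunov V P)
    (h : IsCanonicalBasis P T ν) (hR : IsSymplectic R) (hRV : R * V * Rᴴ = vacuumCov κ)
    (hf : Function.Injective f) (hr : ∀ i, ν i ≠ 0 → i ∈ Set.range f)
    (hr' : ∀ j, ν (f j) ≠ 0) :
    ((G.changeBasis h.symplectic).restrict f).IsGloballyMinimal V := by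
  have hP₁ := hP.canonical h
  exact ((hG.changeBasis h.symplectic).restrict_mixed hP₁ hR hRV h.nonneg hf hr hr'
    |>.isGloballyMinimal_of_isUnit ⟨R, hR, hRV⟩ (hP₁.restrict f)
    ((isUnit_thermalCov_iff fun i => h.nonneg (f i)).2 hr'))

theorem IsHurwitz.isGloballyMinimal_iff (hG : G.IsHurwitz) (hP : G.Lyapunov V P)
    (h : IsCanonicalBasis P T ν) (hR : IsSymplectic R) (hRV : R * V * Rᴴ = vacuumCov κ) :
    G.IsGloballyMinimal V ↔ ∀ i, ν i ≠ 0 := by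
  constructor
  · intro hmin i hi
    have hPh := (hG.posSemidef_lyapunov (hR.posSemidef_of_vacuumCov hRV) hP).isHermitian
    -- The smaller competitor is the mixed part, relabelled by `Fin` as global minimality requires.
    let e := (Fintype.equivFin {i // ν i ≠ 0}).symm
    have hf : Function.Injective fun j => (e j).1 := Subtype.val_injective.comp e.injective
    have hr : ∀ i, ν i ≠ 0 → i ∈ Set.range fun j => (e j).1 := fun i hi =>
      ⟨e.symm ⟨i, hi⟩, by simp⟩
    refine hmin _ (Fintype.card_subtype_lt (not_not.2 hi)) _
      ((hG.changeBasis h.symplectic).restrict_mixed (hP.canonical h) hR hRV h.nonneg hf hr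
        fun j => (e j).2)
      (hP.samePowerSpectrum_restrict hPh h hR hRV hf hr fun j => (e j).2)
  · exact fun hne => hG.isGloballyMinimal_of_isUnit ⟨R, hR, hRV⟩ hP (h.isUnit_iff.2 hne)

end QLS

/-! ### Block triangular drift and the series product. -/

namespace QLS

variable {ι₁ ι₂ κ : Type*} [Fintype ι₁] [DecidableEq ι₁] [Fintype ι₂] [DecidableEq ι₂]
  [Fintype κ] [DecidableEq κ]

theorem padL_eq {ι₁ ι₂ : Type*} [DecidableEq ι₁] [DecidableEq ι₂] :
    padL ι₁ ι₂ = (incl (Sum.map Sum.inl Sum.inl))ᴴ := by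
  ext x y
  simp [padL, incl, one_apply, eq_comm, apply_ite]

theorem padR_eq {ι₁ ι₂ : Type*} [DecidableEq ι₁] [DecidableEq ι₂] :
    padR ι₁ ι₂ = (incl (Sum.map Sum.inr Sum.inr))ᴴ := by
  ext x y
  simp [padR, incl, one_apply, eq_comm, apply_ite]

theorem Jmat_mul_incl {α β : Type*} [Fintype α] [DecidableEq α] [Fintype β] [DecidableEq β]
    (f : β → α) : Jmat α * incl (Sum.map f f) = incl (Sum.map f f) * Jmat β := by
  have h : ∀ i, signJ α (Sum.map f f i) = signJ β i := by rintro (i | i) <;> rfl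
  ext x y
  rw [Jmat_eq_diagonal, Jmat_eq_diagonal, diagonal_mul, mul_diagonal, incl, submatrix_apply,
    one_apply]
  split_ifs with hx
  · rw [← h, ← hx, id, mul_comm]
  · rw [mul_zero, zero_mul]

theorem incl_mul_conjTranspose_add :
    (incl (Sum.map Sum.inl Sum.inl) : Matrix ((ι₁ ⊕ ι₂) ⊕ (ι₁ ⊕ ι₂)) (ι₁ ⊕ ι₁) ℂ)
      * (incl (Sum.map Sum.inl Sum.inl) : Matrix ((ι₁ ⊕ ι₂) ⊕ (ι₁ ⊕ ι₂)) (ι₁ ⊕ ι₁) ℂ)ᴴ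
      + (incl (Sum.map Sum.inr Sum.inr) : Matrix ((ι₁ ⊕ ι₂) ⊕ (ι₁ ⊕ ι₂)) (ι₂ ⊕ ι₂) ℂ)
      * (incl (Sum.map Sum.inr Sum.inr) : Matrix ((ι₁ ⊕ ι₂) ⊕ (ι₁ ⊕ ι₂)) (ι₂ ⊕ ι₂) ℂ)ᴴ = 1 := by
  ext x y
  rw [Matrix.add_apply, mul_apply, mul_apply]
  simp only [incl, conjTranspose_apply, submatrix_apply, one_apply, Fintype.sum_sum_type]
  rcases x with (i | i) | (i | i) <;> rcases y with (j | j) | (j | j) <;> simp [eq_comm]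

/-- A system whose drift does not couple the second modes into the first ones is a series
product. -/
theorem eq_series_of_drift_eq_zero (G : QLS (ι₁ ⊕ ι₂) κ)
    (h : ∀ x y, G.A (Sum.map Sum.inl Sum.inl x) (Sum.map Sum.inr Sum.inr y) = 0) :
    G = series (G.restrict Sum.inr) (G.restrict Sum.inl).dropStatic := by
  set E₁ : Matrix ((ι₁ ⊕ ι₂) ⊕ (ι₁ ⊕ ι₂)) (ι₁ ⊕ ι₁) ℂ := incl (Sum.map Sum.inl Sum.inl) with hE₁
  set E₂ : Matrix ((ι₁ ⊕ ι₂) ⊕ (ι₁ ⊕ ι₂)) (ι₂ ⊕ ι₂) ℂ := incl (Sum.map Sum.inr Sum.inr) with hE₂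
  have hE : E₁ * E₁ᴴ + E₂ * E₂ᴴ = 1 := incl_mul_conjTranspose_add
  have hJ₁ : Jmat (ι₁ ⊕ ι₂) * E₁ = E₁ * Jmat ι₁ := Jmat_mul_incl _
  have hJ₂ : Jmat (ι₁ ⊕ ι₂) * E₂ = E₂ * Jmat ι₂ := Jmat_mul_incl _
  have hJ₁' : E₁ᴴ * Jmat (ι₁ ⊕ ι₂) = Jmat ι₁ * E₁ᴴ := by
    simpa [Jmat_conjTranspose] using congrArg Matrix.conjTranspose hJ₁
  have hJ₂' : E₂ᴴ * Jmat (ι₁ ⊕ ι₂) = Jmat ι₂ * E₂ᴴ := by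
    simpa [Jmat_conjTranspose] using congrArg Matrix.conjTranspose hJ₂
  have hp₁ : padL ι₁ ι₂ = E₁ᴴ := padL_eq
  have hp₂ : padR ι₁ ι₂ = E₂ᴴ := padR_eq
  set C₁ := (G.restrict (Sum.inl : ι₁ → ι₁ ⊕ ι₂)).C with hC₁
  set C₂ := (G.restrict (Sum.inr : ι₂ → ι₁ ⊕ ι₂)).C with hC₂
  have hC₁' : G.C * E₁ = C₁ := by rw [hE₁, mul_incl, hC₁, restrict_C]
  have hC₂' : G.C * E₂ = C₂ := by rw [hE₂, mul_incl, hC₂, restrict_C]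
  have hf₁ : flat C₁ = E₁ᴴ * flat G.C := by
    rw [← hC₁', flat, flat, conjTranspose_mul, ← Matrix.mul_assoc, ← hJ₁']
    simp only [Matrix.mul_assoc]
  have hf₂ : flat C₂ = E₂ᴴ * flat G.C := by
    rw [← hC₂', flat, flat, conjTranspose_mul, ← Matrix.mul_assoc, ← hJ₂']
    simp only [Matrix.mul_assoc]
  have hΩ₁ : E₁ᴴ * G.Ω * E₁ = (G.restrict (Sum.inl : ι₁ → ι₁ ⊕ ι₂)).Ω := by
    rw [hE₁, incl_conjTranspose_mul, mul_incl]; rfl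
  have hΩ₂ : E₂ᴴ * G.Ω * E₂ = (G.restrict (Sum.inr : ι₂ → ι₁ ⊕ ι₂)).Ω := by
    rw [hE₂, incl_conjTranspose_mul, mul_incl]; rfl
  -- The `S^♭` of `dropStatic` cancels the static matrix that the second component applies to the
  -- first output.
  have hstatic : G.S * (flat G.S * C₁ * E₁ᴴ) = C₁ * E₁ᴴ := by
    rw [← Matrix.mul_assoc, ← Matrix.mul_assoc, G.symplectic_S.mul_flat, Matrix.one_mul]
  have hA : E₁ᴴ * G.A * E₂ = 0 := by
    rw [hE₁, hE₂, incl_conjTranspose_mul, mul_incl]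
    ext x y
    exact h x y
  -- A vanishing block of `-½ C^♭ C - i J Ω` determines the same block of `Ω`; the opposite block
  -- follows since `Ω` is Hermitian.
  have hΩ₁₂ : E₁ᴴ * G.Ω * E₂ = -(1 / (2 * Complex.I) : ℂ) • (Jmat ι₁ * (flat C₁ * C₂)) := by
    have h1 : Complex.I • (Jmat ι₁ * (E₁ᴴ * G.Ω * E₂)) = -((1 / 2 : ℂ) • (flat C₁ * C₂)) := by
      rw [A, Matrix.mul_sub, Matrix.sub_mul, sub_eq_zero, Matrix.mul_neg, Matrix.neg_mul,
        Matrix.mul_smul, Matrix.smul_mul, Matrix.mul_smul, Matrix.smul_mul,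
        ← Matrix.mul_assoc E₁ᴴ (Jmat _), hJ₁'] at hA
      rw [hf₁, ← hC₂']
      simp only [Matrix.mul_assoc] at hA ⊢
      exact hA.symm
    have h2 := congrArg (fun X => (-Complex.I) • (Jmat ι₁ * X)) h1
    simp only [Matrix.mul_smul, Matrix.mul_neg, Jmat_mul_cancel, smul_smul, neg_mul,
      Complex.I_mul_I, neg_neg, one_smul, smul_neg, neg_smul] at h2
    rw [h2]
    congr 1
    rw [one_div (2 * Complex.I), mul_inv, Complex.inv_I]
    ring
  have hΩ₂₁ : E₂ᴴ * G.Ω * E₁ = (1 / (2 * Complex.I) : ℂ) • (Jmat ι₂ * (flat C₂ * C₁)) := by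
    have h1 := congrArg Matrix.conjTranspose hΩ₁₂
    have hs : star (-(1 / (2 * Complex.I)) : ℂ) = 1 / (2 * Complex.I) := by
      simp
    rw [conjTranspose_mul, conjTranspose_mul, conjTranspose_conjTranspose, G.hermitian_Ω.eq,
      conjTranspose_smul, hs, conjTranspose_mul, conjTranspose_mul, flat_conjTranspose,
      Jmat_conjTranspose, Matrix.mul_assoc C₂ᴴ, mul_Jmat_cancel, ← Matrix.mul_assoc C₂ᴴ,
      conjTranspose_mul_Jmat, ← Matrix.mul_assoc] at h1
    rw [h1, Matrix.mul_assoc]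
  refine QLS.ext ?_ ?_ ?_
  · simp [series, restrict, dropStatic]
  · change G.C = G.S * (flat G.S * C₁ * padL ι₁ ι₂) + C₂ * padR ι₁ ι₂
    rw [hp₁, hp₂, hstatic, ← hC₁', ← hC₂', Matrix.mul_assoc, Matrix.mul_assoc, ← Matrix.mul_add,
      hE, Matrix.mul_one]
  · change G.Ω = (padL ι₁ ι₂)ᴴ * (G.restrict Sum.inl).Ω * padL ι₁ ι₂
      + (padR ι₁ ι₂)ᴴ * (G.restrict Sum.inr).Ω * padR ι₁ ι₂
      + Jmat (ι₁ ⊕ ι₂) * imFlat (flat (C₂ * padR ι₁ ι₂) * (G.S * (flat G.S * C₁ * padL ι₁ ι₂)))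
    have hflat₁ : flat (C₁ * E₁ᴴ) = E₁ * flat C₁ := by
      rw [flat, flat, conjTranspose_mul, conjTranspose_conjTranspose, ← Matrix.mul_assoc, hJ₁]
      simp only [Matrix.mul_assoc]
    have hflat₂ : flat (C₂ * E₂ᴴ) = E₂ * flat C₂ := by
      rw [flat, flat, conjTranspose_mul, conjTranspose_conjTranspose, ← Matrix.mul_assoc, hJ₂]
      simp only [Matrix.mul_assoc]
    rw [hp₁, hp₂, hstatic, imFlat, QuantumLinear.flat_mul (flat (C₂ * E₂ᴴ)), flat_flat, hflat₁, hflat₂,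
      conjTranspose_conjTranspose, conjTranspose_conjTranspose, ← hΩ₁, ← hΩ₂]
    -- Block expansion of `Ω`: the diagonal blocks are the two Hamiltonians and the off-diagonal
    -- ones form the `Im_♭` term.
    calc G.Ω = (E₁ * E₁ᴴ + E₂ * E₂ᴴ) * G.Ω * (E₁ * E₁ᴴ + E₂ * E₂ᴴ) := by
          rw [hE, Matrix.one_mul, Matrix.mul_one]
      _ = E₁ * (E₁ᴴ * G.Ω * E₁) * E₁ᴴ + E₂ * (E₂ᴴ * G.Ω * E₂) * E₂ᴴ
          + (E₂ * (E₂ᴴ * G.Ω * E₁) * E₁ᴴ + E₁ * (E₁ᴴ * G.Ω * E₂) * E₂ᴴ) := by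
          simp only [Matrix.add_mul, Matrix.mul_add, Matrix.mul_assoc]
          abel
      _ = _ := by
          congr 1
          have h₁ : ∀ X : Matrix (ι₁ ⊕ ι₁) ((ι₁ ⊕ ι₂) ⊕ (ι₁ ⊕ ι₂)) ℂ,
              Jmat (ι₁ ⊕ ι₂) * (E₁ * X) = E₁ * (Jmat ι₁ * X) := fun X => by
            rw [← Matrix.mul_assoc, hJ₁, Matrix.mul_assoc]
          have h₂ : ∀ X : Matrix (ι₂ ⊕ ι₂) ((ι₁ ⊕ ι₂) ⊕ (ι₁ ⊕ ι₂)) ℂ,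
              Jmat (ι₁ ⊕ ι₂) * (E₂ * X) = E₂ * (Jmat ι₂ * X) := fun X => by
            rw [← Matrix.mul_assoc, hJ₂, Matrix.mul_assoc]
          rw [hΩ₁₂, hΩ₂₁]
          simp only [Matrix.mul_smul, Matrix.smul_mul, Matrix.mul_assoc, Matrix.mul_sub, h₁, h₂,
            smul_sub, neg_smul, Matrix.mul_neg, Matrix.neg_mul]
          rw [sub_eq_add_neg]

end QLS

/-! ### The pure component. -/

namespace QLS

variable {ι κ : Type*} [Fintype ι] [DecidableEq ι] [Fintype κ] [DecidableEq κ]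
  {G : QLS ι κ} {V R : Matrix (κ ⊕ κ) (κ ⊕ κ) ℂ} {P T : Matrix (ι ⊕ ι) (ι ⊕ ι) ℂ} {ν : ι → ℝ}

theorem restrict_restrict {ι ι₁ ι₂ : Type*} (G : QLS ι κ) (f : ι₁ → ι) (g : ι₂ → ι₁) :
    (G.restrict f).restrict g = G.restrict (f ∘ g) := by
  refine QLS.ext rfl ?_ ?_
  · simp only [restrict_C, submatrix_submatrix, Sum.map_comp_map, Function.comp_id]
  · simp [restrict, submatrix_submatrix, Sum.map_comp_map]

theorem Lyapunov.restrict_sumCompl_eq_series (hP : G.Lyapunov V P) (h : IsCanonicalBasis P T ν)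
    (hR : IsSymplectic R) (hRV : R * V * Rᴴ = vacuumCov κ) :
    (G.changeBasis h.symplectic).restrict (Equiv.sumCompl fun i => ν i = 0) =
      series (G.mixedPart h) (G.purePart h) := by
  have hP₁ := hP.canonical h
  refine (eq_series_of_drift_eq_zero _ fun x y => ?_).trans ?_
  · rw [restrict_A, submatrix_apply]
    refine hP₁.drift_pure_mixed hR hRV h.nonneg ?_ ?_
    · rcases x with x | x <;> exact x.2
    · rcases y with y | y <;> exact y.2
  · rw [restrict_restrict, restrict_restrict]
    rfl

theorem Lyapunov.purePart_isPassive (hP : G.Lyapunov V P) (h : IsCanonicalBasis P T ν)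
    (hR : IsSymplectic R) (hRV : R * V * Rᴴ = vacuumCov κ) :
    ((G.purePart h).changeField hR).IsPassive := by
  have hP₁ := hP.canonical h
  set G₁ := G.changeBasis h.symplectic with hG₁
  have hU : IsSymplectic (R * flat G₁.S) := hR.mul G₁.symplectic_S.flat
  refine ⟨?_, ?_, ?_⟩
  · have h1 : R * 1 * flat R = fromBlocks 1 0 0 1 := by
      rw [Matrix.mul_one, hR.mul_flat, fromBlocks_one]
    change (R * 1 * flat R).toBlocks₁₂ = 0
    rw [h1, toBlocks_fromBlocks₁₂]
  · ext k i
    have h1 := hP₁.coupling_annihilation_creation hR hRV i.2 k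
    rw [Matrix.mul_assoc] at h1
    change (R * (flat G₁.S * (G₁.restrict Subtype.val).C)) (Sum.inl k) (Sum.inr i) = 0
    rw [restrict_C]
    exact h1
  · ext i j
    change G₁.Ω (Sum.inl i.1) (Sum.inr j.1) = 0
    have h1 := hP₁.drift_annihilation_creation hR hRV i.2 h.nonneg j.1
    have h2 : flat G₁.C * G₁.C = flat (R * flat G₁.S * G₁.C) * (R * flat G₁.S * G₁.C) := by
      rw [QuantumLinear.flat_mul (R * flat G₁.S), Matrix.mul_assoc,
        ← Matrix.mul_assoc (flat (R * flat G₁.S)), hU.flat_mul, Matrix.one_mul]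
    -- Both coupling and drift lack annihilation–creation entries on pure modes. `C^♭ C`, computed
    -- in vacuum field coordinates, then lacks them too, and so does the remaining part `-i J Ω` of
    -- the drift.
    have h3 : (flat G₁.C * G₁.C) (Sum.inl i.1) (Sum.inr j.1) = 0 := by
      rw [h2, mul_apply]
      refine Finset.sum_eq_zero fun w _ => ?_
      rcases w with k | k
      · rw [hP₁.coupling_annihilation_creation hR hRV j.2 k, mul_zero]
      · rw [flat_apply, hP₁.coupling_creation_annihilation hR hRV i.2 k]
        simp
    rw [A, Matrix.sub_apply, Matrix.neg_apply, Matrix.smul_apply, Matrix.smul_apply, h3,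
      Jmat_eq_diagonal, diagonal_mul] at h1
    simpa [signJ] using h1

theorem IsHurwitz.purePart (hG : G.IsHurwitz) (hP : G.Lyapunov V P) (h : IsCanonicalBasis P T ν)
    (hR : IsSymplectic R) (hRV : R * V * Rᴴ = vacuumCov κ) : (G.purePart h).IsHurwitz := by
  unfold IsHurwitz QLS.purePart
  rw [dropStatic_A]
  exact (hG.changeBasis h.symplectic).restrict_pure (hP.canonical h) hR hRV h.nonneg
    Subtype.val_injective (fun i hi => ⟨⟨i, hi⟩, rfl⟩) fun j => j.2

end QLS

/-! ### The theorem. -/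

theorem theorem2 {n m : ℕ} (G : QLS (Fin n) (Fin m)) (hG : G.IsHurwitz)
    (N M : Matrix (Fin m) (Fin m) ℂ) (hV : IsPureState (inputCov N M)) :
    (∃! P, G.Lyapunov (inputCov N M) P) ∧
    ∀ P, G.Lyapunov (inputCov N M) P →
      -- (1)
      (G.IsGloballyMinimal (inputCov N M) ↔ IsFullyMixed P) ∧
      -- a splitting of the modes into pure and mixed ones exists
      (∃ T ν, IsCanonicalBasis P T ν) ∧
      (¬ G.IsGloballyMinimal (inputCov N M) →
        ∀ (T : Matrix (Fin n ⊕ Fin n) (Fin n ⊕ Fin n) ℂ) (ν : Fin n → ℝ)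
          (h : IsCanonicalBasis P T ν),
          -- (2)
          (∃ i, ν i = 0) ∧
          (G.changeBasis h.symplectic).restrict (Equiv.sumCompl fun i => ν i = 0) =
            QLS.series (G.mixedPart h) (G.purePart h) ∧
          (G.purePart h).IsHurwitz ∧
          (∀ (R : Matrix (Fin m ⊕ Fin m) (Fin m ⊕ Fin m) ℂ)
            (hR : IsCanonicalBasis (inputCov N M) R 0),
            ((G.purePart h).changeField hR.symplectic).IsPassive) ∧
          -- (3)
          (G.mixedPart h).IsHurwitz ∧
          (G.mixedPart h).IsGloballyMinimal (inputCov N M) ∧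
          QLS.SamePowerSpectrum G (G.mixedPart h) (inputCov N M)) := by
  obtain ⟨R, hRc⟩ := hV
  have hR := hRc.symplectic
  have hRV : R * inputCov N M * Rᴴ = vacuumCov (Fin m) := hRc.cov_eq
  refine ⟨hG.existsUnique_lyapunov _, fun P hP => ?_⟩
  have hpos := hG.posSemidef_lyapunov (hR.posSemidef_of_vacuumCov hRV) hP
  obtain ⟨T₀, ν₀, h₀⟩ := exists_isCanonicalBasis hpos
    (hG.conjSwap_lyapunov (hR.conjSwap_of_conj conjSwap_vacuumCov hRV) hP)
  refine ⟨(hG.isGloballyMinimal_iff hP h₀ hR hRV).trans h₀.isFullyMixed_iff.symm, ⟨T₀, ν₀, h₀⟩,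
    fun hmin T ν h => ?_⟩
  have hinj : Function.Injective (Subtype.val : {i // ¬ ν i = 0} → Fin n) :=
    Subtype.val_injective
  have hrange : ∀ i, ν i ≠ 0 → i ∈ Set.range (Subtype.val : {i // ¬ ν i = 0} → Fin n) :=
    fun i hi => ⟨⟨i, hi⟩, rfl⟩
  have hne : ∀ j : {i // ¬ ν i = 0}, ν j.1 ≠ 0 := fun j => j.2
  refine ⟨?_, hP.restrict_sumCompl_eq_series h hR hRV, hG.purePart hP h hR hRV,
    fun R' hR' => hP.purePart_isPassive h hR'.symplectic hR'.cov_eq,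
    (hG.changeBasis h.symplectic).restrict_mixed (hP.canonical h) hR hRV h.nonneg hinj hrange hne,
    hG.isGloballyMinimal_restrict hP h hR hRV hinj hrange hne,
    hP.samePowerSpectrum_restrict hpos.1 h hR hRV hinj hrange hne⟩
  -- The criterion holds in every canonical basis, so it applies to the given `T` and not only to
  -- `T₀`.
  rw [hG.isGloballyMinimal_iff hP h hR hRV] at hmin
  simpa using hmin
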